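/- **Setting.** Let $\alpha\in(0,1)$, let $F$ be a probability measure on $\mathbb R$, and write $\overline F(x)=F((x,\infty))$. Let $A$ be strictly positive on $(0,\infty)$ and regularly varying at $\infty$ with exponent $\alpha$, normalised so that $A$ is continuously differentiable and strictly increasing on $(0,\infty)$ with $A(1)=1$. Assume the regular right tail condition $\overline F(x)\sim 1/A(x)$ as $x\to\infty$; nothing is assumed about the left tail. Let $h>0$, $I=(0,h]$, $a_n=\inf\{t\ge 1: A(t)>n\}$ (so $a_0=1$ and $a_n=A^{-1}(n)$ for $n\ge1$), $\kappa=\lfloor 1/\alpha\rfloor$, and let $F^{*n}$ be the $n$-fold convolution of $F$. For $\eta\in(0,1)$, $r\in(0,1]$, $T\ge 0$, put $$\omega(x)=\frac{xF(x+I)}{\overline F(x)},\qquad \widetilde K_{\eta,n,r}(x,T)=\int_{(1-\eta)x}^x e^{-(x-y)/(ra_n)}\,[\omega(y)-T]^+\,dy .$$ Let $X_1,X_2,\dots$ be i.i.d. with law $F$, $S_n^-=\sum_{i\le n}\max(-X_i,0)$, $N_n=\#\{i\le n:X_i>0\}$ and $x_n=x+S_n^-$. For a function $L>0$ on $(0,\infty)$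 and constants $c_1,c_2,\delta>0$ let $$R_{T,\eta,r,c_1,c_2}(x,\delta)=\frac{x}{A(x)}\sum_{L(x)\le n<A(\delta x)}\mathbb E\left[\frac{N_n}{a_{N_n}}\,\frac{\overline F(x_n)}{x_n}\,\sup_{c_1x_n/\kappa\le t\le c_2x_n+2h}\widetilde K_{\eta,N_n,r}(t,T)\right]\in[0,\infty].$$ **Theorem.** There are a constant $C>0$ and a function $\rho$ with $\rho(\delta)=o(\delta^\alpha)$ as $\delta\to0+$, both depending only on $F,A,h$; for every $r\in(0,1]$ a constant $C_r>0$ depending only on $F,A,h,r$; and for every $r\in(0,1]$ and $\eta\in(0,1)$ a number $\delta_0>0$ depending only on $F,A,h,\eta,r$, such that for all functions $L>0$, all $T\ge0$, all $1/2\le c_1<c_0\le1\le c_2$ and all $0<\delta<\delta_0$, $$\limsup_{x\to\infty}\frac{x}{A(x)}\sum_{L(x)\le n<A(\delta x)}\ \sup_{c_0x\le y\le c_2x}F^{*n}(y+I)\ \le\ C_r\limsup_{x\to\infty}R_{T,\eta,r,c_1,c_2}(x,\delta)+C\,\delta^{2\alpha}\,T+\max(\rho(\delta),0).$$ -/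

import Mathlib

open MeasureTheory Filter Topology Set Asymptotics
open scoped ENNReal

noncomputable section

namespace SmallN

/-- `A` is strictly positive and measurable on `(0, ∞)` and regularly varying at `∞` with
exponent `α`. Values of `A` on `(-∞, 0]` are irrelevant. -/
structure IsRegularlyVarying (α : ℝ) (A : ℝ → ℝ) : Prop where
  pos : ∀ x : ℝ, 0 < x → 0 < A x
  meas : Measurable fun x : Ioi (0 : ℝ) => A x
  tendsto : ∀ c : ℝ, 0 < c → Tendsto (fun x => A (c * x) / A x) atTop (𝓝 (c ^ α))

/-- The right tail `1 - F(x) = F((x, ∞))` of a probability measure on `ℝ`. -/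
def tail (F : Measure ℝ) (x : ℝ) : ℝ := F.real (Ioi x)

/-- The `n`-fold self-convolution of `F`; the `0`-fold one is the unit mass at `0`. -/
def convPow (F : Measure ℝ) : ℕ → Measure ℝ
  | 0 => Measure.dirac 0
  | n + 1 => (convPow F n).conv F

/-- `a_n = inf {t ≥ 1 : A(t) > n}`. When `A` is continuous and strictly increasing on `(0, ∞)`,
tends to `∞` and has `A(1) = 1`, this is `A⁻¹(n)` for `n ≥ 1`, and `a_0 = 1`. -/
def aSeq (A : ℝ → ℝ) (n : ℕ) : ℝ := sInf {t : ℝ | 1 ≤ t ∧ (n : ℝ) < A t}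

/-- `ω(x) = x F(x + I) / F((x, ∞))` with `I = (0, h]`. -/
def omega (F : Measure ℝ) (h x : ℝ) : ℝ := x * F.real (Ioc x (x + h)) / tail F x

/-- The weighted overflow integral
`∫_{(1-η)x}^x exp(-(x-y)/(r a_n)) [ω(y) - T]⁺ dy`, as an element of `[0, ∞]`. -/
def overflow (F : Measure ℝ) (A : ℝ → ℝ) (h η r T : ℝ) (n : ℕ) (x : ℝ) : ℝ≥0∞ :=
  ∫⁻ y in Ioc ((1 - η) * x) x,
    ENNReal.ofReal (Real.exp (-(x - y) / (r * aSeq A n)) * max (omega F h y - T) 0)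

/-- `N_n`: the number of strictly positive steps among the `n` steps `s`. -/
def numPos {n : ℕ} (s : Fin n → ℝ) : ℕ := Nat.card {i : Fin n // 0 < s i}

/-- `S_n⁻`: the sum of the negative parts of the `n` steps `s`. -/
def negSum {n : ℕ} (s : Fin n → ℝ) : ℝ := ∑ i, max (-(s i)) 0

/-- `R_{T,η,r,c₁,c₂}(x, δ)`, in `[0, ∞]`. The expectation is over `n` independent steps with
law `F`, that is, over the product measure on `Fin n → ℝ`; here `x_n = x + S_n⁻` and
`κ = ⌊1/α⌋`. The sum is over the integers `n` with `L(x) ≤ n < A(δx)`. -/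
def bigR (F : Measure ℝ) (A : ℝ → ℝ) (α h : ℝ) (L : ℝ → ℝ) (T η r c₁ c₂ δ x : ℝ) : ℝ≥0∞ :=
  ENNReal.ofReal (x / A x) *
    ∑ n ∈ Finset.Ico ⌈L x⌉₊ ⌈A (δ * x)⌉₊,
      ∫⁻ s : Fin n → ℝ,
        ENNReal.ofReal ((numPos s : ℝ) / aSeq A (numPos s) *
            (tail F (x + negSum s) / (x + negSum s))) *
          ⨆ t ∈ Icc (c₁ * (x + negSum s) / (⌊1 / α⌋₊ : ℝ)) (c₂ * (x + negSum s) + 2 * h),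
            overflow F A h η r T (numPos s) t
        ∂(Measure.pi fun _ : Fin n => F)

/-- The small-`n` contribution
`(x / A(x)) ∑_{L(x) ≤ n < A(δx)} sup_{c₀x ≤ y ≤ c₂x} F^{*n}(y + I)` with `I = (0, h]`. -/
def smallN (F : Measure ℝ) (A : ℝ → ℝ) (h : ℝ) (L : ℝ → ℝ) (c₀ c₂ δ x : ℝ) : ℝ≥0∞ :=
  ENNReal.ofReal (x / A x) *
    ∑ n ∈ Finset.Ico ⌈L x⌉₊ ⌈A (δ * x)⌉₊,
      ⨆ y ∈ Icc (c₀ * x) (c₂ * x), convPow F n (Ioc y (y + h))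

end SmallN

end

/-! Conditionally on the signs and the negative parts of the steps, the positive steps are i.i.d.
with law `posLaw F`, so F^{*n}(y + I) is the expectation of the mass that the N_n-fold convolution
of `posLaw F` gives to y + S_n⁻ + I (`lintegral_convPow_eq`). This removes the left tail: it
suffices to bound P^{*m}(z + I) for P = `posLaw F`, c₀u ≤ z ≤ c₂u and m ≤ A(δu), with u = x_n ≥ x
and m = N_n ≤ n < A(δx) ≤ A(δu). That bound is `local_large_deviation`. It separates the case where
some step exceeds c'u/κ, for a c' strictly between c₁ and c₀, from the case where none does.

If no step exceeds c'u/κ, then κ steps add up to at most c'u < c₀u. Either κ + 1 steps are of order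
u, or the small steps alone must produce a sum of order u, and a Chernoff bound makes that equally
unlikely. With the factor 1/a_m from concentration the cost is (m/A(u))^{κ+1}/a_m
(`convPow_truncated_le`), and since (κ+1)α > 1 this is O(δ^e/u) for some e > 0 (`exists_rate`).
Multiplied by x/A(x) and summed over n < A(δx), it contributes O(δ^{α+e}) = o(δ^α), which is ρ.

If some step is large, single it out. The sum of the other steps smooths at scale a_m
(`locBound_convPow`), so only the mass that F gives to intervals of length about r a_m near order u
matters. By Fubini that mass is an integral of F(y + I) = ω(y) F̄(y)/y, and ω ≤ T + [ω - T]⁺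
(`single_jump_le_overflow`). The part [ω - T]⁺ gives the overflow integral in R. The part T gives T
m F̄(u)/u, which sums to order T A(δx)²F̄(x)/A(x), with limit T δ^{2α}.

The constants C and ρ must not depend on c₀, c₁, r, although the bound for sums without a large step
degenerates as c₀ - c₁ → 0. `convPow_truncated_le_rate` deals with this by lowering δ for small m,
and by using regular variation of the tail on macroscopic intervals for the remaining m. -/

noncomputable section

namespace SmallN

/-- A continuous, strictly increasing function on `(0, ∞)`, regularly varying with exponent
`α ∈ (0, 1)`, normalised by `A 1 = 1`. -/
structure NormalizedScale (α : ℝ) (A : ℝ → ℝ) : Prop where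
  exponent_pos : 0 < α
  exponent_lt_one : α < 1
  regular : IsRegularlyVarying α A
  cont : ContinuousOn A (Ioi 0)
  mono : StrictMonoOn A (Ioi 0)
  one : A 1 = 1

/-! ### Potter bounds for A and growth of its inverse a_n. -/

namespace NormalizedScale

variable {α : ℝ} {A : ℝ → ℝ}

lemma le_of_le (hA : NormalizedScale α A) {x y : ℝ} (hx : 0 < x) (hxy : x ≤ y) : A x ≤ A y :=
  hA.mono.monotoneOn (mem_Ioi.2 hx) (mem_Ioi.2 (hx.trans_le hxy)) hxy

lemma one_le (hA : NormalizedScale α A) {x : ℝ} (hx : 1 ≤ x) : 1 ≤ A x := by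
  rw [← hA.one]; exact hA.le_of_le one_pos hx

lemma pos (hA : NormalizedScale α A) {x : ℝ} (hx : 0 < x) : 0 < A x := hA.regular.pos x hx

/-- Since β < α, A(2x) ≥ 2^β A(x) beyond some x₁, and this inequality is iterated along powers of 2.
Below x₁ monotonicity suffices; the constant (2x₁)^(-β) pays for that range and for rounding y/v to
a power of 2. -/
lemma potter_lower (hA : NormalizedScale α A) {β : ℝ} (hβ0 : 0 < β) (hβ : β < α) :
    ∃ c : ℝ, 0 < c ∧ ∀ v y : ℝ, 1 ≤ v → v ≤ y → c * (y / v) ^ β * A v ≤ A y := by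
  have h2 : (2 : ℝ) ^ β < 2 ^ α := Real.rpow_lt_rpow_of_exponent_lt (by norm_num) hβ
  have hev := (hA.regular.tendsto 2 two_pos).eventually (lt_mem_nhds h2)
  obtain ⟨x₀, hx₀⟩ := eventually_atTop.1 hev
  set x₁ := max x₀ 1 with hx₁
  have hx₁1 : 1 ≤ x₁ := le_max_right _ _
  have step : ∀ x, x₁ ≤ x → (2 : ℝ) ^ β * A x ≤ A (2 * x) := fun x hx => by
    have hxp : 0 < x := by linarith
    have := hx₀ x ((le_max_left _ _).trans hx)
    exact ((lt_div_iff₀ (hA.pos hxp)).1 this).le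
  have iter : ∀ (k : ℕ) x, x₁ ≤ x → ((2 : ℝ) ^ k) ^ β * A x ≤ A (2 ^ k * x) := by
    intro k
    induction k with
    | zero => intro x _; simp
    | succ k ih =>
      intro x hx
      have h1 := ih (2 * x) (by linarith)
      have h2 := step x hx
      have e : (2 : ℝ) ^ (k + 1) * x = 2 ^ k * (2 * x) := by ring
      rw [e]
      refine le_trans ?_ h1
      rw [pow_succ, Real.mul_rpow (by positivity) (by norm_num), mul_assoc]
      gcongr
  refine ⟨(2 * x₁) ^ (-β), by positivity, fun v y hv hvy => ?_⟩
  have hv0 : 0 < v := by linarith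
  have hy0 : 0 < y := by linarith
  have hpos := hA.pos hv0
  by_cases hy : y ≤ x₁
  · have : (2 * x₁) ^ (-β) * (y / v) ^ β ≤ 1 := by
      rw [Real.rpow_neg (by positivity), inv_mul_le_iff₀ (by positivity), mul_one]
      gcongr
      rw [div_le_iff₀ hv0]; nlinarith
    calc _ ≤ 1 * A v := by gcongr
      _ = A v := one_mul _
      _ ≤ A y := hA.le_of_le hv0 hvy
  · push Not at hy
    set w := max v x₁ with hw
    have hw0 : 0 < w := lt_max_of_lt_left hv0
    have hwy : w ≤ y := max_le hvy hy.le
    obtain ⟨k, hk1, hk2⟩ := exists_nat_pow_near (x := y / w) (y := (2 : ℝ))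
      ((one_le_div hw0).2 hwy) (by norm_num)
    have h1 := iter k w (le_max_right _ _)
    have h3 : A (2 ^ k * w) ≤ A y := hA.le_of_le (by positivity) ((le_div_iff₀ hw0).1 hk1)
    have h4 : A v ≤ A w := hA.le_of_le hv0 (le_max_left _ _)
    refine le_trans ?_ (h1.trans h3)
    gcongr
    rw [Real.rpow_neg (by positivity), inv_mul_le_iff₀ (by positivity),
      ← Real.mul_rpow (by positivity) (by positivity)]
    gcongr
    have hwv : w ≤ v * x₁ := max_le (by nlinarith) (by nlinarith)
    rw [div_lt_iff₀ hw0] at hk2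
    rw [div_le_iff₀ hv0]
    calc y ≤ 2 ^ (k + 1) * w := hk2.le
      _ ≤ 2 ^ (k + 1) * (v * x₁) := by gcongr
      _ = _ := by ring

lemma potter_upper (hA : NormalizedScale α A) {β : ℝ} (hβ : α < β) :
    ∃ C : ℝ, 0 < C ∧ ∀ v y : ℝ, 1 ≤ v → v ≤ y → A y ≤ C * (y / v) ^ β * A v := by
  have hβ0 : 0 < β := hA.exponent_pos.trans hβ
  have h2 : (2 : ℝ) ^ α < 2 ^ β := Real.rpow_lt_rpow_of_exponent_lt (by norm_num) hβ
  have hev := (hA.regular.tendsto 2 two_pos).eventually (gt_mem_nhds h2)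
  obtain ⟨x₀, hx₀⟩ := eventually_atTop.1 hev
  set x₁ := max x₀ 1 with hx₁
  have hx₁1 : 1 ≤ x₁ := le_max_right _ _
  have step : ∀ x, x₁ ≤ x → A (2 * x) ≤ (2 : ℝ) ^ β * A x := fun x hx => by
    have hxp : 0 < x := by linarith
    have := hx₀ x ((le_max_left _ _).trans hx)
    exact ((div_lt_iff₀ (hA.pos hxp)).1 this).le
  have iter : ∀ (k : ℕ) x, x₁ ≤ x → A (2 ^ k * x) ≤ ((2 : ℝ) ^ k) ^ β * A x := by
    intro k
    induction k with
    | zero => intro x _; simp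
    | succ k ih =>
      intro x hx
      have h1 := ih (2 * x) (by linarith)
      have h2 := step x hx
      have e : (2 : ℝ) ^ (k + 1) * x = 2 ^ k * (2 * x) := by ring
      rw [e]
      refine le_trans h1 ?_
      rw [pow_succ, Real.mul_rpow (by positivity) (by norm_num), mul_assoc]
      gcongr
  have hAx := hA.one_le hx₁1
  refine ⟨2 ^ β * A x₁, by positivity, fun v y hv hvy => ?_⟩
  have hv0 : 0 < v := by linarith
  have hy0 : 0 < y := by linarith
  have hpos := hA.pos hv0
  set w := max v x₁ with hw
  have hw0 : 0 < w := lt_max_of_lt_left hv0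
  obtain ⟨k, hk1, hk2⟩ := exists_nat_pow_near (x := max y w / w) (y := (2 : ℝ))
    ((one_le_div hw0).2 (le_max_right _ _)) (by norm_num)
  have h1 := iter (k + 1) w (le_max_right _ _)
  have h3 : A y ≤ A (2 ^ (k + 1) * w) := by
    refine hA.le_of_le hy0 ((le_max_left y w).trans ?_)
    exact ((div_lt_iff₀ hw0).1 hk2).le
  have hm : max y w / w ≤ y / v := by
    rw [div_le_div_iff₀ hw0 hv0]
    rcases le_total y w with h | h
    · rw [max_eq_right h, mul_comm]; gcongr
    · rw [max_eq_left h]; gcongr; exact le_max_left _ _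
  have hAw := hA.pos hw0
  have h4 : A w ≤ A x₁ * A v := by
    have h1v := hA.one_le hv
    rcases le_total v x₁ with h | h
    · rw [hw, max_eq_right h]; nlinarith
    · rw [hw, max_eq_left h]; nlinarith
  calc A y ≤ ((2 : ℝ) ^ (k + 1)) ^ β * A w := h3.trans h1
    _ ≤ (2 * (y / v)) ^ β * (A x₁ * A v) := by
        gcongr
        rw [pow_succ, mul_comm]
        gcongr
        exact hk1.trans hm
    _ = _ := by rw [Real.mul_rpow (by norm_num) (by positivity)]; ring

lemma tendsto_atTop (hA : NormalizedScale α A) : Tendsto A atTop atTop := by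
  have hα := hA.exponent_pos
  obtain ⟨c, hc, H⟩ := hA.potter_lower (half_pos hα) (half_lt_self hα)
  have h1 : Tendsto (fun y : ℝ => c * y ^ (α / 2)) atTop atTop :=
    (tendsto_rpow_atTop (half_pos hα)).const_mul_atTop hc
  refine tendsto_atTop_mono' _ ?_ h1
  filter_upwards [eventually_ge_atTop 1] with y hy
  have := H 1 y le_rfl hy
  simpa [hA.one] using this

lemma exists_eq (hA : NormalizedScale α A) {t : ℝ} (ht : 1 ≤ t) : ∃ v, 1 ≤ v ∧ A v = t := by
  obtain ⟨b, hb, hb'⟩ := ((hA.tendsto_atTop.eventually_ge_atTop t).and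
    (eventually_ge_atTop 1)).exists
  have hc : ContinuousOn A (Icc 1 b) :=
    hA.cont.mono fun x hx => mem_Ioi.2 (lt_of_lt_of_le one_pos hx.1)
  obtain ⟨v, hv, hv'⟩ := intermediate_value_Icc hb' hc ⟨by rw [hA.one]; exact ht, hb⟩
  exact ⟨v, hv.1, hv'⟩

/-- The maximum with 1 accounts for m = 0, where the infimum is the endpoint 1 and A takes the value
1 rather than 0. -/
lemma aSeq_spec (hA : NormalizedScale α A) (m : ℕ) :
    1 ≤ aSeq A m ∧ A (aSeq A m) = max (m : ℝ) 1 := by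
  obtain ⟨v, hv, hv'⟩ := hA.exists_eq (le_max_right (m : ℝ) 1)
  suffices h : aSeq A m = v by rw [h]; exact ⟨hv, hv'⟩
  rcases Nat.eq_zero_or_pos m with rfl | hm
  · have hv1 : v = 1 := by
      refine hA.mono.injOn (mem_Ioi.2 (by linarith)) (mem_Ioi.2 one_pos) ?_
      rw [hv', hA.one]; simp
    have : {t : ℝ | 1 ≤ t ∧ ((0 : ℕ) : ℝ) < A t} = Ici 1 := by
      ext t; simp only [Nat.cast_zero, mem_ofPred_eq, mem_Ici, and_iff_left_iff_imp]
      intro ht; exact hA.pos (by linarith)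
    rw [aSeq, this, csInf_Ici, hv1]
  · have hm1 : (1 : ℝ) ≤ m := by exact_mod_cast hm
    rw [max_eq_left hm1] at hv'
    have : {t : ℝ | 1 ≤ t ∧ (m : ℝ) < A t} = Ioi v := by
      ext t; simp only [mem_ofPred_eq, mem_Ioi]
      rw [← hv']
      constructor
      · rintro ⟨ht, h⟩
        exact (hA.mono.lt_iff_lt (mem_Ioi.2 (by linarith)) (mem_Ioi.2 (by linarith))).1 h
      · intro h
        exact ⟨by linarith, hA.mono (mem_Ioi.2 (by linarith)) (mem_Ioi.2 (by linarith)) h⟩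
    rw [aSeq, this, csInf_Ioi]

lemma one_le_aSeq (hA : NormalizedScale α A) (m : ℕ) : 1 ≤ aSeq A m := (hA.aSeq_spec m).1

lemma aSeq_pos (hA : NormalizedScale α A) (m : ℕ) : 0 < aSeq A m :=
  one_pos.trans_le (hA.one_le_aSeq m)

lemma apply_aSeq (hA : NormalizedScale α A) (m : ℕ) : A (aSeq A m) = max (m : ℝ) 1 :=
  (hA.aSeq_spec m).2

lemma aSeq_le (hA : NormalizedScale α A) {m : ℕ} {v : ℝ} (hv : 1 ≤ v) (h : m ≤ A v) :
    aSeq A m ≤ v := by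
  by_contra! hlt
  have := hA.mono (mem_Ioi.2 (by linarith)) (mem_Ioi.2 (hA.aSeq_pos m)) hlt
  rw [hA.apply_aSeq] at this
  exact absurd this (not_lt.2 (max_le h (hA.one_le hv)))

lemma le_aSeq (hA : NormalizedScale α A) {m : ℕ} {v : ℝ} (hv : 0 < v) (h : A v ≤ m) :
    v ≤ aSeq A m := by
  rw [← hA.mono.le_iff_le (mem_Ioi.2 hv) (mem_Ioi.2 (hA.aSeq_pos m)), hA.apply_aSeq]
  exact h.trans (le_max_left _ _)

/-- The scales of comparable numbers of steps are comparable. This allows half of the steps, or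
boundedly many of them, to be discarded at the cost of a constant. -/
lemma aSeq_le_mul_aSeq (hA : NormalizedScale α A) (D : ℝ) :
    ∃ C : ℝ, 1 ≤ C ∧ ∀ m j : ℕ, (m : ℝ) ≤ D * (j + 1) → aSeq A m ≤ C * aSeq A j := by
  have hα := hA.exponent_pos
  obtain ⟨c, hc, H⟩ := hA.potter_lower (half_pos hα) (half_lt_self hα)
  set M := max (2 * D / c) 1 with hM
  have hM1 : 1 ≤ M := le_max_right _ _
  have hMD : 2 * D ≤ c * M := by
    have := (div_le_iff₀ hc).1 (le_max_left (2 * D / c) 1); linarith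
  set l := M ^ (1 / (α / 2)) with hl
  have hl1 : 1 ≤ l := Real.one_le_rpow hM1 (by positivity)
  have hlM : l ^ (α / 2) = M := by
    rw [hl, ← Real.rpow_mul (by linarith), one_div_mul_cancel (by positivity), Real.rpow_one]
  refine ⟨l, hl1, fun m j hmj => ?_⟩
  have hb := hA.one_le_aSeq j
  have hb0 := hA.aSeq_pos j
  have hlb : aSeq A j ≤ l * aSeq A j := le_mul_of_one_le_left hb0.le hl1
  refine hA.aSeq_le (hb.trans hlb) ?_
  have h1 := H _ _ hb hlb
  rw [mul_div_cancel_right₀ _ hb0.ne', hlM, hA.apply_aSeq] at h1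
  refine le_trans ?_ h1
  have h2 : ((j : ℝ) + 1) ≤ 2 * max (j : ℝ) 1 := by
    have := le_max_left (j : ℝ) 1; have := le_max_right (j : ℝ) 1; linarith
  have h3 : (0 : ℝ) ≤ j := j.cast_nonneg
  have hmax : 0 < max (j : ℝ) 1 := lt_max_of_lt_right one_pos
  rcases le_total D 0 with hD | hD
  · have : (m : ℝ) ≤ 0 := hmj.trans (mul_nonpos_of_nonpos_of_nonneg hD (by linarith))
    exact this.trans (by positivity)
  · calc (m : ℝ) ≤ D * (j + 1) := hmj
      _ ≤ D * (2 * max (j : ℝ) 1) := by gcongr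
      _ = 2 * D * max (j : ℝ) 1 := by ring
      _ ≤ _ := by gcongr

/-- The sequence grows polynomially, by the lower Potter bound; an exponential bound is enough to
absorb 8^(-m/2) into 1/a_{m+1} in `locBound_convPow`. -/
lemma aSeq_le_two_pow (hA : NormalizedScale α A) :
    ∃ C : ℝ, 0 < C ∧ ∀ m : ℕ, aSeq A m ≤ C * 2 ^ m := by
  have hα := hA.exponent_pos
  obtain ⟨c, hc, H⟩ := hA.potter_lower (half_pos hα) (half_lt_self hα)
  obtain ⟨N, hN⟩ := exists_nat_ge (1 / (α / 2))
  have ht := tendsto_pow_const_div_const_pow_of_one_lt N (r := 2) one_lt_two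
  obtain ⟨B, hB⟩ := ht.bddAbove_range
  set B' := max B 1
  have hB' : ∀ m : ℕ, (max (m : ℝ) 1) ^ N ≤ B' * 2 ^ m := fun m => by
    have h2 : (1 : ℝ) ≤ 2 ^ m := one_le_pow₀ one_le_two
    rcases Nat.eq_zero_or_pos m with rfl | hm
    · simp [B']
    · have hm1 : (1 : ℝ) ≤ m := by exact_mod_cast hm
      rw [max_eq_left hm1]
      have := hB ⟨m, rfl⟩
      simp only at this
      rw [div_le_iff₀ (by positivity)] at this
      exact this.trans (by gcongr; exact le_max_left _ _)
  refine ⟨(max (1 / c) 1) ^ N * B', by positivity, fun m => ?_⟩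
  have ha := hA.one_le_aSeq m
  have h1 := H 1 (aSeq A m) le_rfl ha
  rw [hA.apply_aSeq, hA.one, div_one, mul_one] at h1
  set M := max (m : ℝ) 1
  have hM : 1 ≤ M := le_max_right _ _
  have h2 : (aSeq A m) ^ (α / 2) ≤ max (1 / c) 1 * M := by
    have : (aSeq A m) ^ (α / 2) ≤ 1 / c * M := by
      rw [one_div, ← div_eq_inv_mul, le_div_iff₀ hc]; linarith
    exact this.trans (by gcongr; exact le_max_left _ _)
  have h3 : 1 ≤ max (1 / c) 1 * M := one_le_mul_of_one_le_of_one_le (le_max_right _ _) hM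
  calc aSeq A m = ((aSeq A m) ^ (α / 2)) ^ (1 / (α / 2)) := by
        rw [← Real.rpow_mul (by linarith), mul_one_div_cancel (by positivity), Real.rpow_one]
    _ ≤ (max (1 / c) 1 * M) ^ (1 / (α / 2)) := by gcongr
    _ ≤ (max (1 / c) 1 * M) ^ (N : ℝ) := Real.rpow_le_rpow_of_exponent_le h3 hN
    _ = (max (1 / c) 1) ^ N * M ^ N := by rw [Real.rpow_natCast, mul_pow]
    _ ≤ (max (1 / c) 1) ^ N * (B' * 2 ^ m) := by gcongr; exact hB' m
    _ = _ := by ring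

end NormalizedScale

/-! ### Convolution inequalities on intervals. -/

section Convolution

instance isFiniteMeasure_convPow (F : Measure ℝ) [IsFiniteMeasure F] (n : ℕ) :
    IsFiniteMeasure (convPow F n) := by
  induction n with
  | zero => rw [convPow]; infer_instance
  | succ n ih => rw [convPow]; infer_instance

instance isProbabilityMeasure_convPow (F : Measure ℝ) [IsProbabilityMeasure F] (n : ℕ) :
    IsProbabilityMeasure (convPow F n) := by
  induction n with
  | zero => rw [convPow]; infer_instance
  | succ n ih => rw [convPow]; infer_instance

lemma convPow_add (F : Measure ℝ) [IsFiniteMeasure F] (m n : ℕ) :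
    convPow F (m + n) = (convPow F m).conv (convPow F n) := by
  induction n with
  | zero => simp [convPow]
  | succ n ih => rw [← add_assoc, convPow, convPow, ih, Measure.conv_assoc]

lemma convPow_succ' (F : Measure ℝ) [IsFiniteMeasure F] (n : ℕ) :
    convPow F (n + 1) = F.conv (convPow F n) := by
  rw [convPow, Measure.conv_comm]

lemma conv_apply (μ ν : Measure ℝ) [SFinite ν] {s : Set ℝ} (hs : MeasurableSet s) :
    μ.conv ν s = ∫⁻ x, ν ((fun y => x + y) ⁻¹' s) ∂μ := by
  rw [← lintegral_indicator_one hs, Measure.lintegral_conv (measurable_one.indicator hs)]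
  refine lintegral_congr fun x => ?_
  rw [← lintegral_indicator_one (measurable_const_add x hs)]
  rfl

lemma conv_Ioc (μ ν : Measure ℝ) [SFinite ν] (z h : ℝ) :
    μ.conv ν (Ioc z (z + h)) = ∫⁻ x, ν (Ioc (z - x) (z - x + h)) ∂μ := by
  rw [conv_apply _ _ measurableSet_Ioc]
  refine lintegral_congr fun x => ?_
  congr 1
  ext y
  simp only [mem_preimage, mem_Ioc]
  constructor <;> rintro ⟨h1, h2⟩ <;> constructor <;> linarith

lemma conv_mono {μ μ' ν ν' : Measure ℝ} [SFinite ν] [SFinite ν'] (h : μ ≤ μ') (h' : ν ≤ ν') :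
    μ.conv ν ≤ μ'.conv ν' := by
  refine Measure.le_iff.2 fun s hs => ?_
  rw [conv_apply _ _ hs, conv_apply _ _ hs]
  exact lintegral_mono' h fun x => h' _

lemma convPow_mono {G P : Measure ℝ} [IsFiniteMeasure G] [IsFiniteMeasure P] (h : G ≤ P) (n : ℕ) :
    convPow G n ≤ convPow P n := by
  induction n with
  | zero => exact le_rfl
  | succ n ih => rw [convPow, convPow]; exact conv_mono ih h

lemma conv_Ioc_le (μ ν : Measure ℝ) [SFinite ν] {h : ℝ} {B : ℝ≥0∞}
    (hB : ∀ w, ν (Ioc w (w + h)) ≤ B) (z : ℝ) : μ.conv ν (Ioc z (z + h)) ≤ μ univ * B := by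
  rw [conv_Ioc]
  calc _ ≤ ∫⁻ _, B ∂μ := lintegral_mono fun x => hB _
    _ = _ := by rw [lintegral_const, mul_comm]

/-- If a sum exceeds z, one summand is at least z/2. Conditioning on that summand leaves the other
free to supply the local bound, so a tail bound and a concentration bound multiply. -/
lemma conv_Ioc_le_halves (μ ν : Measure ℝ) [IsFiniteMeasure μ] [IsFiniteMeasure ν] {h : ℝ}
    {B B' : ℝ≥0∞} (hB : ∀ w, ν (Ioc w (w + h)) ≤ B) (hB' : ∀ w, μ (Ioc w (w + h)) ≤ B') (z : ℝ) :
    μ.conv ν (Ioc z (z + h)) ≤ μ (Ici (z / 2)) * B + ν (Ici (z / 2)) * B' := by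
  have hsplit : μ = μ.restrict (Ici (z / 2)) + μ.restrict (Iio (z / 2)) := by
    rw [← compl_Ici, Measure.restrict_add_restrict_compl measurableSet_Ici]
  have h1 : (μ.restrict (Iio (z / 2))).conv ν (Ioc z (z + h)) ≤
      (ν.restrict (Ici (z / 2))).conv μ (Ioc z (z + h)) := by
    rw [Measure.conv_comm _ μ, conv_Ioc, conv_Ioc]
    refine le_trans ?_ (lintegral_mono' (Measure.restrict_le_self (s := Iio (z / 2))) fun x => le_rfl)
    refine setLIntegral_mono' measurableSet_Iio fun x hx => ?_
    rw [Measure.restrict_apply measurableSet_Ioc]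
    refine measure_mono fun y hy => ⟨hy, ?_⟩
    have := mem_Iio.1 hx
    exact mem_Ici.2 (by linarith [hy.1])
  calc μ.conv ν (Ioc z (z + h))
      = (μ.restrict (Ici (z / 2))).conv ν (Ioc z (z + h)) +
        (μ.restrict (Iio (z / 2))).conv ν (Ioc z (z + h)) := by
        conv_lhs => rw [hsplit]
        rw [Measure.add_conv, Measure.add_apply]
    _ ≤ _ := by
        refine add_le_add ?_ (h1.trans ?_)
        · refine (conv_Ioc_le _ _ hB z).trans (by simp)
        · refine (conv_Ioc_le _ _ hB' z).trans (by simp)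

lemma convPow_Iio_zero (P : Measure ℝ) [IsFiniteMeasure P] (hP : P (Iio 0) = 0) (n : ℕ) :
    convPow P n (Iio 0) = 0 := by
  induction n with
  | zero => simp [convPow]
  | succ n ih =>
    rw [convPow, conv_apply _ _ measurableSet_Iio, lintegral_eq_zero_iff']
    · have : ∀ᵐ x ∂(convPow P n), 0 ≤ x := by
        rw [ae_iff]; simpa [Iio_def] using ih
      filter_upwards [this] with x hx
      refine measure_mono_null (fun y hy => ?_) hP
      have : x + y < 0 := hy
      exact mem_Iio.2 (by linarith)
    · exact (measurable_measure_prodMk_left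
        ((measurable_fst.add measurable_snd) measurableSet_Iio)).aemeasurable

/-- Either no step is charged by `H`, or one of them is singled out. -/
lemma convPow_add_measure_le (G H : Measure ℝ) [IsFiniteMeasure G] [IsFiniteMeasure H] (m : ℕ) :
    convPow (G + H) (m + 1) ≤
      convPow G (m + 1) + ((m + 1 : ℕ) : ℝ≥0∞) • H.conv (convPow (G + H) m) := by
  induction m with
  | zero => simp [convPow]
  | succ m ih =>
    have hG : convPow (G + H) (m + 1) ≤ _ := ih
    have hfin : IsFiniteMeasure (((m + 1 : ℕ) : ℝ≥0∞) • H.conv (convPow (G + H) m)) :=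
      Measure.smul_finite _ (by simp)
    calc convPow (G + H) (m + 1 + 1)
        = (convPow (G + H) (m + 1)).conv G + (convPow (G + H) (m + 1)).conv H := by
          rw [convPow, Measure.conv_add]
      -- In the product with `G` the inductive split is applied; in the product with `H` the last
      -- step is already the one singled out.
      _ ≤ (convPow G (m + 1) + ((m + 1 : ℕ) : ℝ≥0∞) • H.conv (convPow (G + H) m)).conv G +
          H.conv (convPow (G + H) (m + 1)) := by
          rw [Measure.conv_comm _ H]
          gcongr
          exact conv_mono ih le_rfl
      _ = convPow G (m + 1 + 1) + ((m + 1 : ℕ) : ℝ≥0∞) • H.conv ((convPow (G + H) m).conv G) +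
          H.conv (convPow (G + H) (m + 1)) := by
          rw [Measure.add_conv, Measure.conv_smul_left, Measure.conv_assoc]; rfl
      _ ≤ convPow G (m + 1 + 1) + ((m + 1 : ℕ) : ℝ≥0∞) • H.conv (convPow (G + H) (m + 1)) +
          H.conv (convPow (G + H) (m + 1)) := by
          gcongr
          refine conv_mono le_rfl (conv_mono le_rfl ?_)
          exact Measure.le_add_right le_rfl
      _ = _ := by
          rw [add_assoc]
          congr 1
          conv_lhs => rw [← one_smul ℝ≥0∞ (H.conv (convPow (G + H) (m + 1))), smul_smul, ← add_smul]
          congr 1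
          push_cast; ring

lemma lintegral_exp_convPow (G : Measure ℝ) [IsFiniteMeasure G] (l : ℝ) (n : ℕ) :
    ∫⁻ y, ENNReal.ofReal (Real.exp (l * y)) ∂(convPow G n) =
      (∫⁻ y, ENNReal.ofReal (Real.exp (l * y)) ∂G) ^ n := by
  have hm : Measurable fun y : ℝ => ENNReal.ofReal (Real.exp (l * y)) := by fun_prop
  induction n with
  | zero => simp [convPow, lintegral_dirac' _ hm]
  | succ n ih =>
    rw [convPow, Measure.lintegral_conv hm, pow_succ, ← ih, ← lintegral_mul_const _ hm]
    refine lintegral_congr fun x => ?_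
    rw [← lintegral_const_mul _ hm]
    refine lintegral_congr fun y => ?_
    rw [← ENNReal.ofReal_mul (Real.exp_pos _).le, ← Real.exp_add, mul_add]

lemma measure_Ici_le_exp (μ : Measure ℝ) {l : ℝ} (hl : 0 ≤ l) (w : ℝ) :
    μ (Ici w) ≤ ENNReal.ofReal (Real.exp (-(l * w))) *
      ∫⁻ y, ENNReal.ofReal (Real.exp (l * y)) ∂μ := by
  have hm : Measurable fun y : ℝ => ENNReal.ofReal (Real.exp (l * y)) := by fun_prop
  rw [← lintegral_const_mul _ hm, ← lintegral_indicator_one measurableSet_Ici]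
  refine lintegral_mono fun y => ?_
  by_cases hy : y ∈ Ici w
  · rw [indicator_of_mem hy, Pi.one_apply, ← ENNReal.ofReal_mul (Real.exp_pos _).le,
      ← Real.exp_add, ← ENNReal.ofReal_one]
    refine ENNReal.ofReal_le_ofReal (Real.one_le_exp ?_)
    have := mul_le_mul_of_nonneg_left (mem_Ici.1 hy) hl
    linarith
  · simp [indicator_of_notMem hy]

end Convolution

/-! ### Exponential moments of truncated positive steps. -/

/-- A probability law on `(0, ∞)` whose tail is comparable to `1 / A` and regularly varying with
exponent `-α`. -/
structure StepLaw (α : ℝ) (A : ℝ → ℝ) (P : Measure ℝ) : Prop where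
  scale : NormalizedScale α A
  support : P (Iic 0) = 0
  le_tail : ∃ c : ℝ, 0 < c ∧ ∀ x, 1 ≤ x → c / A x ≤ tail P x
  tail_le : ∃ C : ℝ, 0 < C ∧ ∀ x, 1 ≤ x → tail P x ≤ C / A x
  regular : ∀ c : ℝ, 0 < c → Tendsto (fun x => tail P (c * x) / tail P x) atTop (𝓝 (c ^ (-α)))

lemma ofReal_tail (P : Measure ℝ) [IsFiniteMeasure P] (x : ℝ) :
    ENNReal.ofReal (tail P x) = P (Ioi x) := by
  rw [tail, measureReal_def, ENNReal.ofReal_toReal (measure_ne_top _ _)]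

namespace StepLaw

variable {α : ℝ} {A : ℝ → ℝ} {P : Measure ℝ}

lemma Iio_zero (hP : StepLaw α A P) : P (Iio 0) = 0 :=
  measure_mono_null Iio_subset_Iic_self hP.support

lemma ae_nonneg (hP : StepLaw α A P) : ∀ᵐ y ∂P, 0 ≤ y := by
  rw [ae_iff]; simpa [Iio_def] using hP.Iio_zero

variable [IsProbabilityMeasure P]

lemma measure_Ioi_le (hP : StepLaw α A P) :
    ∃ C : ℝ, 0 < C ∧ ∀ x, 1 ≤ x → P (Ioi x) ≤ ENNReal.ofReal (C / A x) := by
  obtain ⟨C, hC, H⟩ := hP.tail_le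
  refine ⟨C, hC, fun x hx => ?_⟩
  rw [← ofReal_tail]
  exact ENNReal.ofReal_le_ofReal (H x hx)

/-- The layer-cake formula with the tail bound C/A(t) and Potter's bound 1/A(t) ≤ C'(b/t)^γ/A(b).
Because α < 1, γ can be taken in (α, 1), and t^(-γ) is then integrable at 0. -/
lemma truncated_mean_le (hP : StepLaw α A P) :
    ∃ C : ℝ, 0 < C ∧ ∀ b, 1 ≤ b →
      ∫⁻ y, ENNReal.ofReal y ∂(P.restrict (Iic b)) ≤ ENNReal.ofReal (C * b / A b) := by
  have hA := hP.scale
  obtain ⟨C, hC, H⟩ := hP.measure_Ioi_le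
  set γ := (α + 1) / 2 with hγ
  have hα1 := hA.exponent_lt_one
  have hα0 := hA.exponent_pos
  have hγ0 : 0 < γ := by linarith
  have hγ1 : γ < 1 := by linarith
  obtain ⟨C', hC', H'⟩ := hA.potter_upper (β := γ) (by linarith)
  refine ⟨max C 1 * C' / (1 - γ), by have : 0 < 1 - γ := by linarith
                                     positivity, fun b hb => ?_⟩
  have hb0 : 0 < b := by linarith
  have hAb := hA.pos hb0
  have hbound : ∀ t ∈ Ioc 0 b, P (Ioi t) ≤
      ENNReal.ofReal (max C 1 * C' * b ^ γ / A b * t ^ (-γ)) := by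
    intro t ht
    have ht0 : 0 < t := ht.1
    have key : 1 / A (max t 1) ≤ C' * (b / t) ^ γ / A b := by
      have h1 := H' (max t 1) b (le_max_right _ _) (max_le ht.2 hb)
      have hAm := hA.pos (lt_max_of_lt_left ht0 : 0 < max t 1)
      rw [div_le_div_iff₀ hAm hAb, one_mul]
      refine h1.trans ?_
      gcongr
      exact le_max_left _ _
    have e : max C 1 * C' * b ^ γ / A b * t ^ (-γ) = max C 1 * (C' * (b / t) ^ γ / A b) := by
      rw [Real.div_rpow hb0.le ht0.le, Real.rpow_neg ht0.le]; ring
    rw [e]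
    rcases le_total 1 t with h1 | h1
    · rw [max_eq_left h1] at key
      refine (H t h1).trans (ENNReal.ofReal_le_ofReal ?_)
      rw [div_eq_mul_one_div]
      have : 0 < 1 / A t := one_div_pos.2 (hA.pos ht0)
      gcongr
      exact le_max_left _ _
    · rw [max_eq_right h1, hA.one, div_one] at key
      refine prob_le_one.trans ?_
      rw [← ENNReal.ofReal_one]
      refine ENNReal.ofReal_le_ofReal ?_
      calc (1 : ℝ) = 1 * 1 := by norm_num
        _ ≤ _ := by gcongr; exact le_max_right _ _
  have hnn : 0 ≤ᵐ[P.restrict (Iic b)] fun y : ℝ => y := by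
    exact ae_restrict_of_ae hP.ae_nonneg
  rw [lintegral_eq_lintegral_meas_lt _ hnn aemeasurable_id']
  have h1 : ∫⁻ t in Ioi 0, P.restrict (Iic b) {a : ℝ | t < a} ≤
      ∫⁻ t in Ioc 0 b, ENNReal.ofReal (max C 1 * C' * b ^ γ / A b * t ^ (-γ)) := by
    rw [← lintegral_indicator measurableSet_Ioi, ← lintegral_indicator measurableSet_Ioc]
    refine lintegral_mono fun t => ?_
    by_cases ht : t ∈ Ioc 0 b
    · rw [indicator_of_mem (mem_Ioi.2 ht.1), indicator_of_mem ht]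
      exact (Measure.restrict_apply_le _ _).trans (hbound t ht)
    · by_cases ht0 : 0 < t
      · have hbt : b < t := by by_contra! h; exact ht ⟨ht0, h⟩
        rw [indicator_of_mem (mem_Ioi.2 ht0), indicator_of_notMem ht]
        rw [nonpos_iff_eq_zero, Measure.restrict_apply' measurableSet_Iic]
        convert measure_empty (μ := P)
        ext y
        simp only [mem_inter_iff, mem_ofPred_eq, mem_Iic, mem_empty_iff_false, iff_false, not_and,
          not_le]
        intro h; linarith
      · rw [indicator_of_notMem (by simpa using ht0)]; exact zero_le
  refine h1.trans ?_
  have hint : IntervalIntegrable (fun t : ℝ => t ^ (-γ)) volume 0 b :=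
    intervalIntegral.intervalIntegrable_rpow' (by linarith)
  rw [← ofReal_integral_eq_lintegral_ofReal]
  · refine ENNReal.ofReal_le_ofReal ?_
    rw [integral_const_mul, ← intervalIntegral.integral_of_le hb0.le,
      integral_rpow (Or.inl (by linarith)), Real.zero_rpow (by linarith), sub_zero]
    have e : b ^ γ * b ^ (-γ + 1) = b := by
      rw [← Real.rpow_add hb0]; simp
    have : max C 1 * C' * b ^ γ / A b * (b ^ (-γ + 1) / (-γ + 1)) =
        max C 1 * C' / (1 - γ) * (b ^ γ * b ^ (-γ + 1)) / A b := by
      rw [show -γ + 1 = 1 - γ by ring]; ring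
    rw [this, e]
  · exact ((intervalIntegrable_iff_integrableOn_Ioc_of_le hb0.le).1 hint).const_mul _
  · filter_upwards [ae_restrict_mem measurableSet_Ioc] with t ht
    have := ht.1
    positivity

lemma chernoff (hP : StepLaw α A P) :
    ∃ C : ℝ, 0 < C ∧ ∀ b l w : ℝ, 1 ≤ b → 0 ≤ l → ∀ j : ℕ,
      convPow (P.restrict (Iic b)) j (Ici w) ≤
        ENNReal.ofReal (Real.exp (j * (C * Real.exp (2 * l * b) / A b) - l * w)) := by
  obtain ⟨C, hC, H⟩ := hP.truncated_mean_le
  refine ⟨C, hC, fun b l w hb hl j => ?_⟩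
  have hb0 : 0 < b := by linarith
  have hAb := hP.scale.pos hb0
  -- For 0 ≤ y ≤ b, exp(ly) ≤ 1 + l y exp(lb), and lb ≤ exp(lb) absorbs the factor l. The
  -- exponential moment is thereby reduced to the truncated mean.
  have hpt : ∀ᵐ y ∂(P.restrict (Iic b)), ENNReal.ofReal (Real.exp (l * y)) ≤
      1 + ENNReal.ofReal (Real.exp (2 * l * b) / b) * ENNReal.ofReal y := by
    filter_upwards [ae_restrict_mem measurableSet_Iic, ae_restrict_of_ae hP.ae_nonneg] with y hy hy0
    rw [← ENNReal.ofReal_mul (by positivity), ← ENNReal.ofReal_one,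
      ← ENNReal.ofReal_add zero_le_one (by positivity)]
    refine ENNReal.ofReal_le_ofReal ?_
    have hyb : y ≤ b := hy
    have h1 : Real.exp (l * y) ≤ 1 + l * y * Real.exp (l * y) := by
      have h := Real.add_one_le_exp (-(l * y))
      have hp := Real.exp_pos (l * y)
      have e : Real.exp (-(l * y)) * Real.exp (l * y) = 1 := by rw [← Real.exp_add]; simp
      nlinarith
    have h2 : l * b ≤ Real.exp (l * b) := by linarith [Real.add_one_le_exp (l * b)]
    have h3 : Real.exp (2 * l * b) = Real.exp (l * b) * Real.exp (l * b) := by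
      rw [← Real.exp_add]; ring_nf
    have h4 : Real.exp (l * y) ≤ Real.exp (l * b) := by gcongr
    calc Real.exp (l * y) ≤ 1 + l * y * Real.exp (l * y) := h1
      _ ≤ 1 + l * y * Real.exp (l * b) := by gcongr
      _ = 1 + (l * b) * Real.exp (l * b) / b * y := by field_simp
      _ ≤ 1 + Real.exp (l * b) * Real.exp (l * b) / b * y := by gcongr
      _ = _ := by rw [h3]
  have hM : ∫⁻ y, ENNReal.ofReal (Real.exp (l * y)) ∂(P.restrict (Iic b)) ≤
      ENNReal.ofReal (Real.exp (C * Real.exp (2 * l * b) / A b)) := by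
    calc _ ≤ ∫⁻ y, (1 + ENNReal.ofReal (Real.exp (2 * l * b) / b) * ENNReal.ofReal y)
          ∂(P.restrict (Iic b)) := lintegral_mono_ae hpt
      _ ≤ 1 + ENNReal.ofReal (Real.exp (2 * l * b) / b) * ENNReal.ofReal (C * b / A b) := by
          rw [lintegral_add_left measurable_const, lintegral_const_mul _ (by fun_prop)]
          gcongr
          · rw [lintegral_const, one_mul]; simpa using prob_le_one
          · exact H b hb
      _ = ENNReal.ofReal (1 + C * Real.exp (2 * l * b) / A b) := by
          rw [← ENNReal.ofReal_mul (by positivity), ENNReal.ofReal_add zero_le_one (by positivity),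
            ENNReal.ofReal_one]
          congr 2
          field_simp
      _ ≤ _ := by
          refine ENNReal.ofReal_le_ofReal ?_
          rw [add_comm]; exact Real.add_one_le_exp _
  refine (measure_Ici_le_exp _ hl w).trans ?_
  rw [lintegral_exp_convPow]
  calc _ ≤ ENNReal.ofReal (Real.exp (-(l * w))) *
        (ENNReal.ofReal (Real.exp (C * Real.exp (2 * l * b) / A b))) ^ j := by gcongr
    _ = _ := by
        rw [← ENNReal.ofReal_pow (Real.exp_pos _).le, ← Real.exp_nat_mul,
          ← ENNReal.ofReal_mul (Real.exp_pos _).le, ← Real.exp_add]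
        congr 2; ring

end StepLaw

/-! ### Concentration functions through characteristic functions. -/

section Concentration

lemma integral_prod_cos (ν : Measure ℝ) [IsFiniteMeasure ν] (t : ℝ) :
    ∫ p : ℝ × ℝ, Real.cos (t * (p.1 - p.2)) ∂(ν.prod ν) =
      (∫ x, Real.cos (t * x) ∂ν) ^ 2 + (∫ x, Real.sin (t * x) ∂ν) ^ 2 := by
  have hb : ∀ f : ℝ × ℝ → ℝ, Measurable f → (∀ p, ‖f p‖ ≤ 1) → Integrable f (ν.prod ν) :=
    fun f hf h1 => Integrable.of_bound hf.aestronglyMeasurable 1 (Eventually.of_forall h1)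
  have e : ∀ p : ℝ × ℝ, Real.cos (t * (p.1 - p.2)) =
      Real.cos (t * p.1) * Real.cos (t * p.2) + Real.sin (t * p.1) * Real.sin (t * p.2) := by
    intro p; rw [mul_sub, Real.cos_sub]
  simp_rw [e]
  rw [integral_add, integral_prod_mul (fun x => Real.cos (t * x)) (fun x => Real.cos (t * x)),
    integral_prod_mul (fun x => Real.sin (t * x)) (fun x => Real.sin (t * x)), sq, sq]
  · refine hb _ (by fun_prop) fun p => ?_
    rw [norm_mul]
    exact mul_le_one₀ (Real.abs_cos_le_one _) (norm_nonneg _) (Real.abs_cos_le_one _)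
  · refine hb _ (by fun_prop) fun p => ?_
    rw [norm_mul]
    exact mul_le_one₀ (Real.abs_sin_le_one _) (norm_nonneg _) (Real.abs_sin_le_one _)

lemma charFun_re_im (μ : Measure ℝ) [IsFiniteMeasure μ] (t : ℝ) :
    (charFun μ t).re = ∫ x, Real.cos (t * x) ∂μ ∧ (charFun μ t).im = ∫ x, Real.sin (t * x) ∂μ := by
  have hi : Integrable (fun x : ℝ => Complex.exp (t * x * Complex.I)) μ := by
    refine Integrable.of_bound (by fun_prop) 1 (Eventually.of_forall fun x => ?_)
    rw [← Complex.ofReal_mul, Complex.norm_exp_ofReal_mul_I]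
  rw [charFun_apply_real]
  have hexp : ∀ x : ℝ, Complex.exp (t * x * Complex.I) =
      (Real.cos (t * x) : ℂ) + (Real.sin (t * x) : ℂ) * Complex.I := fun x => by
    rw [Complex.ofReal_cos, Complex.ofReal_sin, Complex.ofReal_mul, Complex.exp_mul_I]
  constructor
  · rw [← Complex.reCLM_apply, ← Complex.reCLM.integral_comp_comm hi]
    refine integral_congr_ae (Eventually.of_forall fun x => ?_)
    simp [hexp, -Complex.ofReal_cos, -Complex.ofReal_sin]
  · rw [← Complex.imCLM_apply, ← Complex.imCLM.integral_comp_comm hi]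
    refine integral_congr_ae (Eventually.of_forall fun x => ?_)
    simp [hexp, -Complex.ofReal_cos, -Complex.ofReal_sin]

/-- Esseen's concentration inequality. -/
lemma measure_Ioc_le_integral_charFun (μ : Measure ℝ) [IsProbabilityMeasure μ] {h ε : ℝ}
    (hε : 0 < ε) (hεh : ε * h ≤ 1) (w : ℝ) :
    μ.real (Ioc w (w + h)) ≤ 4 / ε * ∫ t in (-ε)..ε, ‖charFun μ t‖ := by
  set ν := volume.restrict (Ioc (0 : ℝ) ε) with hν
  have hνu : ν.real univ = ε := by simp [hν, measureReal_def, hε.le]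
  -- `K y` is the squared modulus of ∫₀^ε exp(iyt) dt: it is nonnegative, at least ε²/4 on [0, h],
  -- and a mixture of the frequencies p₁ - p₂, which lie in [-ε, ε].
  set K : ℝ → ℝ := fun y => ∫ p : ℝ × ℝ, Real.cos (y * (p.1 - p.2)) ∂(ν.prod ν) with hK
  have hK0 : ∀ y, 0 ≤ K y := fun y => by
    simp only [hK]; rw [integral_prod_cos]; positivity
  have hK1 : ∀ y ∈ Icc 0 h, ε ^ 2 / 4 ≤ K y := fun y hy => by
    have h1 : ε / 2 ≤ ∫ x, Real.cos (y * x) ∂ν := by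
      have : ∫ x, (1 / 2 : ℝ) ∂ν ≤ ∫ x, Real.cos (y * x) ∂ν := by
        refine integral_mono_ae (integrable_const _) ?_ ?_
        · exact Integrable.of_bound (by fun_prop) 1
            (Eventually.of_forall fun x => Real.abs_cos_le_one _)
        · filter_upwards [ae_restrict_mem measurableSet_Ioc] with x hx
          have h0 : 0 ≤ y * x := mul_nonneg hy.1 hx.1.le
          have h2 : y * x ≤ 1 := by
            calc y * x ≤ h * ε := mul_le_mul hy.2 hx.2 hx.1.le (hy.1.trans hy.2)
              _ ≤ 1 := by linarith
          have := Real.one_sub_sq_div_two_le_cos (x := y * x)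
          nlinarith
      rw [integral_const, hνu, smul_eq_mul] at this
      linarith
    simp only [hK]; rw [integral_prod_cos]
    nlinarith [sq_nonneg (∫ x, Real.sin (y * x) ∂ν)]
  have hcm : Measurable fun q : ℝ × (ℝ × ℝ) => Real.cos ((q.1 - w) * (q.2.1 - q.2.2)) := by
    fun_prop
  have hint : Integrable (fun q : ℝ × (ℝ × ℝ) => Real.cos ((q.1 - w) * (q.2.1 - q.2.2)))
      (μ.prod (ν.prod ν)) :=
    Integrable.of_bound hcm.aestronglyMeasurable 1
      (Eventually.of_forall fun x => Real.abs_cos_le_one _)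
  have h1 : ε ^ 2 / 4 * μ.real (Ioc w (w + h)) ≤ ∫ y, K (y - w) ∂μ := by
    have : ∫ y, (Ioc w (w + h)).indicator (fun _ => ε ^ 2 / 4) y ∂μ ≤ ∫ y, K (y - w) ∂μ := by
      refine integral_mono ((integrable_const _).indicator measurableSet_Ioc)
        hint.integral_prod_left fun y => ?_
      by_cases hy : y ∈ Ioc w (w + h)
      · rw [indicator_of_mem hy]
        exact hK1 _ ⟨by linarith [hy.1], by linarith [hy.2]⟩
      · rw [indicator_of_notMem hy]; exact hK0 _
    rw [integral_indicator measurableSet_Ioc, setIntegral_const, smul_eq_mul] at this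
    linarith
  have hφ : Measurable fun t : ℝ => ‖charFun μ t‖ := measurable_charFun.norm
  have hφ1 : ∀ t : ℝ, ‖charFun μ t‖ ≤ 1 := fun t => norm_charFun_le_one t
  have h2 : ∫ y, K (y - w) ∂μ ≤ ∫ p : ℝ × ℝ, ‖charFun μ (p.1 - p.2)‖ ∂(ν.prod ν) := by
    simp only [hK]
    rw [integral_integral_swap hint]
    refine integral_mono hint.integral_prod_right ?_ fun p => ?_
    · exact Integrable.of_bound (by fun_prop) 1 (Eventually.of_forall fun p => by simp [hφ1])
    · set t := p.1 - p.2
      obtain ⟨hre, him⟩ := charFun_re_im μ t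
      have e : ∫ y, Real.cos ((y - w) * t) ∂μ =
          Real.cos (t * w) * (charFun μ t).re + Real.sin (t * w) * (charFun μ t).im := by
        rw [hre, him, ← integral_const_mul, ← integral_const_mul, ← integral_add]
        · refine integral_congr_ae (Eventually.of_forall fun y => ?_)
          simp only
          rw [sub_mul, Real.cos_sub, mul_comm y, mul_comm w]; ring
        · exact (Integrable.of_bound (by fun_prop) 1
            (Eventually.of_forall fun x => Real.abs_cos_le_one _)).const_mul _
        · exact (Integrable.of_bound (by fun_prop) 1
            (Eventually.of_forall fun x => Real.abs_sin_le_one _)).const_mul _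
      simp only
      rw [e, Complex.norm_def, Complex.normSq_apply]
      refine Real.le_sqrt_of_sq_le ?_
      have := Real.sin_sq_add_cos_sq (t * w)
      set c := Real.cos (t * w)
      set s := Real.sin (t * w)
      set a := (charFun μ t).re
      set b := (charFun μ t).im
      have e2 : a * a + b * b - (c * a + s * b) ^ 2 =
        (c * b - s * a) ^ 2 + (1 - (s ^ 2 + c ^ 2)) * (a * a + b * b) := by ring
      rw [this] at e2
      nlinarith [sq_nonneg (c * b - s * a)]
  have h3 : ∫ p : ℝ × ℝ, ‖charFun μ (p.1 - p.2)‖ ∂(ν.prod ν) ≤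
      ε * ∫ t in (-ε)..ε, ‖charFun μ t‖ := by
    have hI : Integrable (fun p : ℝ × ℝ => ‖charFun μ (p.1 - p.2)‖) (ν.prod ν) :=
      Integrable.of_bound (by fun_prop) 1 (Eventually.of_forall fun p => by simp [hφ1])
    rw [integral_prod _ hI]
    have : ∫ x, ∫ y, ‖charFun μ (x - y)‖ ∂ν ∂ν ≤ ∫ x, (∫ t in (-ε)..ε, ‖charFun μ t‖) ∂ν := by
      refine integral_mono_ae hI.integral_prod_left (integrable_const _) ?_
      filter_upwards [ae_restrict_mem measurableSet_Ioc] with x hx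
      rw [hν, ← intervalIntegral.integral_of_le hε.le,
        intervalIntegral.integral_comp_sub_left (fun t => ‖charFun μ t‖)]
      refine intervalIntegral.integral_mono_interval (by linarith [hx.1]) (by linarith)
        (by linarith [hx.2]) (Eventually.of_forall fun t => norm_nonneg _) ?_
      exact intervalIntegrable_charFun.norm
    rwa [integral_const, hνu, smul_eq_mul] at this
  have h4 := h1.trans (h2.trans h3)
  rw [div_mul_eq_mul_div, le_div_iff₀ hε]
  have : ε * (μ.real (Ioc w (w + h)) * ε) ≤ ε * (4 * ∫ t in (-ε)..ε, ‖charFun μ t‖) := by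
    nlinarith
  exact le_of_mul_le_mul_left this hε

end Concentration

lemma charFun_convPow (P : Measure ℝ) [IsProbabilityMeasure P] (n : ℕ) (t : ℝ) :
    charFun (convPow P n) t = charFun P t ^ n := by
  induction n with
  | zero => simp [convPow]
  | succ n ih => rw [convPow, charFun_conv, ih, pow_succ]

lemma tail_pos_of_le (P : Measure ℝ) [IsFiniteMeasure P] {x y : ℝ} (h : x ≤ y)
    (hy : 0 < tail P y) : 0 < tail P x :=
  hy.trans_le (measureReal_mono (Ioi_subset_Ioi h))

namespace StepLaw

variable {α : ℝ} {A : ℝ → ℝ} {P : Measure ℝ} [IsProbabilityMeasure P]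

lemma tail_pos (hP : StepLaw α A P) (x : ℝ) : 0 < tail P x := by
  obtain ⟨c, hc, H⟩ := hP.le_tail
  refine tail_pos_of_le P (le_max_left x 1) ?_
  exact (div_pos hc (hP.scale.pos (lt_max_of_lt_right one_pos))).trans_le (H _ (le_max_right _ _))

/-- |φ(t)|² is the expectation of cos(t(X - X')) for independent copies. With probability of order
1/A(1/t), X lies in (1/t, 2/t] while X' ≤ M; the angle then lies in [1/2, 2], where the cosine is at
most 19/20. Regular variation, and not merely comparability with 1/A, ensures that (1/t, 2/t]
carries a fixed proportion of the tail. -/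
lemma norm_charFun_sq_le (hP : StepLaw α A P) :
    ∃ c ε : ℝ, 0 < c ∧ 0 < ε ∧ ε ≤ 1 ∧ ∀ t, 0 < t → t ≤ ε →
      ‖charFun P t‖ ^ 2 ≤ 1 - c / A (1 / t) := by
  have hα := hP.scale.exponent_pos
  obtain ⟨c₁, hc₁, H₁⟩ := hP.le_tail
  obtain ⟨q, hq1, hq2⟩ : ∃ q : ℝ, (2 : ℝ) ^ (-α) < q ∧ q < 1 :=
    exists_between (Real.rpow_lt_one_of_one_lt_of_neg one_lt_two (by linarith))
  obtain ⟨x₀, hx₀⟩ := eventually_atTop.1 ((hP.regular 2 two_pos).eventually (gt_mem_nhds hq1))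
  obtain ⟨M, hM0, hM⟩ : ∃ M : ℝ, 0 < M ∧ 1 / 2 ≤ P.real (Iic M) := by
    have h1 : Tendsto (fun x : ℝ => P (Iic x)) atTop (𝓝 (P univ)) :=
      tendsto_measure_Iic_atTop P
    have h2 : (ENNReal.ofReal (1 / 2)) < P univ := by
      rw [measure_univ, ← ENNReal.ofReal_one]
      exact (ENNReal.ofReal_lt_ofReal_iff one_pos).2 (by norm_num)
    obtain ⟨M, hM, hM0⟩ := ((h1.eventually (lt_mem_nhds h2)).and (eventually_gt_atTop 0)).exists
    refine ⟨M, hM0, ?_⟩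
    rw [measureReal_def]
    exact (ENNReal.ofReal_le_iff_le_toReal (measure_ne_top _ _)).1 hM.le
  have hMIoc : 1 / 2 ≤ P.real (Ioc 0 M) := by
    refine hM.trans (le_of_eq ?_)
    rw [measureReal_def, measureReal_def]
    congr 1
    refine le_antisymm ?_ (measure_mono Ioc_subset_Iic_self)
    calc P (Iic M) ≤ P (Iic 0 ∪ Ioc 0 M) := measure_mono (by rw [Iic_union_Ioc_eq_Iic hM0.le])
      _ ≤ P (Iic 0) + P (Ioc 0 M) := measure_union_le _ _
      _ = _ := by rw [hP.support, zero_add]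
  refine ⟨c₁ * (1 - q) / 40, min (min (1 / (2 * M)) 1) (1 / max x₀ 1), ?_, by positivity, ?_, ?_⟩
  · have : 0 < 1 - q := by linarith
    positivity
  · exact (min_le_left _ _).trans (min_le_right _ _)
  intro t ht htε
  have htM : t * M ≤ 1 / 2 := by
    have : t ≤ 1 / (2 * M) := htε.trans ((min_le_left _ _).trans (min_le_left _ _))
    rw [le_div_iff₀ (by positivity)] at this; linarith
  have ht1 : 1 ≤ 1 / t := by
    rw [le_div_iff₀ ht, one_mul]; exact htε.trans ((min_le_left _ _).trans (min_le_right _ _))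
  have htx : x₀ ≤ 1 / t := by
    have : t ≤ 1 / max x₀ 1 := htε.trans (min_le_right _ _)
    rw [le_div_iff₀ (by positivity)] at this
    rw [le_div_iff₀ ht]
    have := le_max_left x₀ 1
    nlinarith
  have hE : (c₁ * (1 - q)) / A (1 / t) ≤ P.real (Ioc (1 / t) (2 * (1 / t))) := by
    have e : P.real (Ioc (1 / t) (2 * (1 / t))) = tail P (1 / t) - tail P (2 * (1 / t)) := by
      rw [tail, tail, ← measureReal_sdiff (Ioi_subset_Ioi (by linarith)) measurableSet_Ioi]
      congr 1
      ext y; simp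
    have h1 := hx₀ _ htx
    rw [div_lt_iff₀ (hP.tail_pos _)] at h1
    have h2 := H₁ _ ht1
    have h3 : 0 ≤ 1 - q := by linarith
    rw [e]
    calc _ = (1 - q) * (c₁ / A (1 / t)) := by ring
      _ ≤ (1 - q) * tail P (1 / t) := by gcongr
      _ ≤ _ := by linarith
  obtain ⟨hre, him⟩ := charFun_re_im P t
  have hn : ‖charFun P t‖ ^ 2 = ∫ p : ℝ × ℝ, Real.cos (t * (p.1 - p.2)) ∂(P.prod P) := by
    rw [integral_prod_cos, ← hre, ← him, Complex.sq_norm, Complex.normSq_apply]; ring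
  set S := Ioc (1 / t) (2 * (1 / t)) ×ˢ Ioc 0 M with hS
  have hSm : MeasurableSet S := measurableSet_Ioc.prod measurableSet_Ioc
  have hbd : ∀ p : ℝ × ℝ, Real.cos (t * (p.1 - p.2)) ≤ 1 - S.indicator (fun _ => (1 / 20 : ℝ)) p := by
    intro p
    by_cases hp : p ∈ S
    · rw [indicator_of_mem hp]
      obtain ⟨⟨ha, hb⟩, hc, hd⟩ := hp
      have h1 : 1 < t * p.1 := by rw [div_lt_iff₀ ht] at ha; linarith
      have h2 : t * p.1 ≤ 2 := by
        have := mul_le_mul_of_nonneg_left hb ht.le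
        have e : t * (2 * (1 / t)) = 2 := by field_simp
        linarith
      have h3 : t * p.2 ≤ 1 / 2 := (mul_le_mul_of_nonneg_left hd ht.le).trans htM
      have h4 : 0 < t * p.2 := mul_pos ht hc
      have hθ1 : 1 / 2 ≤ t * (p.1 - p.2) := by rw [mul_sub]; linarith
      have hθ2 : t * (p.1 - p.2) ≤ 2 := by rw [mul_sub]; linarith
      set θ := t * (p.1 - p.2)
      have hpi := Real.pi_gt_three
      have hpi2 := Real.pi_lt_d2
      have := Real.cos_le_one_sub_mul_cos_sq (x := θ) (by rw [abs_le]; constructor <;> linarith)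
      refine this.trans ?_
      have h5 : (1 / 20 : ℝ) ≤ 2 / Real.pi ^ 2 * θ ^ 2 := by
        rw [div_mul_eq_mul_div, div_le_div_iff₀ (by norm_num) (by positivity)]
        nlinarith
      linarith
    · rw [indicator_of_notMem hp, sub_zero]; exact Real.cos_le_one _
  have hfin : ∫ p : ℝ × ℝ, Real.cos (t * (p.1 - p.2)) ∂(P.prod P) ≤
      1 - 1 / 20 * (P.real (Ioc (1 / t) (2 * (1 / t))) * P.real (Ioc 0 M)) := by
    refine (integral_mono ?_ ?_ hbd).trans ?_
    · exact Integrable.of_bound (by fun_prop) 1 (Eventually.of_forall fun x => Real.abs_cos_le_one _)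
    · exact (integrable_const _).sub ((integrable_const _).indicator hSm)
    · rw [integral_sub (integrable_const _) ((integrable_const _).indicator hSm),
        integral_indicator hSm, setIntegral_const, hS, measureReal_prod_prod]
      simp only [integral_const, smul_eq_mul, mul_one, probReal_univ]
      linarith
  rw [hn]
  refine hfin.trans ?_
  have h0 : 0 ≤ P.real (Ioc (1 / t) (2 * (1 / t))) := measureReal_nonneg
  have : c₁ * (1 - q) / 40 / A (1 / t) = 1 / 20 * ((c₁ * (1 - q)) / A (1 / t) * (1 / 2)) := by ring
  rw [this]
  have := mul_le_mul hE hMIoc (by norm_num) h0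
  linarith

/-- Here |φ(t)|^j ≤ exp(-cj/(2A(1/t))). Since A(a_j) = j for j ≥ 1, the lower Potter bound turns
this into a multiple of exp(-k(a_j t)^β), whose integral scales like 1/a_j; Esseen's inequality then
applies. -/
lemma concentration (hP : StepLaw α A P) {h : ℝ} (hh : 0 < h) :
    ∃ C : ℝ, 0 < C ∧ ∀ (j : ℕ) (w : ℝ),
      convPow P j (Ioc w (w + h)) ≤ ENNReal.ofReal (C / aSeq A j) := by
  have hA := hP.scale
  have hα := hA.exponent_pos
  obtain ⟨c, ε₀, hc, hε₀, hε₁, H⟩ := hP.norm_charFun_sq_le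
  set β := α / 2 with hβ
  have hβ0 : 0 < β := half_pos hα
  obtain ⟨c', hc', H'⟩ := hA.potter_lower hβ0 (half_lt_self hα)
  set ε := min ε₀ (1 / h) with hε
  have hεp : 0 < ε := by positivity
  have hεh : ε * h ≤ 1 := by
    have : ε ≤ 1 / h := min_le_right _ _
    rwa [le_div_iff₀ hh] at this
  set k := c * c' / 2 with hk
  have hk0 : 0 < k := by positivity
  set C₀ := 8 / ε * Real.exp k * (k ^ (-1 / β) * Real.Gamma (1 / β + 1)) with hC₀
  have hG : 0 < Real.Gamma (1 / β + 1) := Real.Gamma_pos_of_pos (by positivity)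
  have hC₀0 : 0 < C₀ := by positivity
  refine ⟨max C₀ 1, by positivity, fun j w => ?_⟩
  have ha := hA.aSeq_pos j
  rcases Nat.eq_zero_or_pos j with rfl | hj
  · have : aSeq A 0 = 1 := le_antisymm (hA.aSeq_le le_rfl (by simp [hA.one])) (hA.one_le_aSeq 0)
    rw [this, div_one]
    refine prob_le_one.trans ?_
    rw [← ENNReal.ofReal_one]; exact ENNReal.ofReal_le_ofReal (le_max_right _ _)
  have hj1 : (1 : ℝ) ≤ j := by exact_mod_cast hj
  have hAa : A (aSeq A j) = j := by rw [hA.apply_aSeq, max_eq_left hj1]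
  set a := aSeq A j with haj
  have hpt : ∀ t ∈ Ioc 0 ε, ‖charFun (convPow P j) t‖ ≤
      Real.exp k * Real.exp (-(k * a ^ β) * t ^ β) := by
    intro t ht
    have ht0 : 0 < t := ht.1
    have hsq := H t ht0 (ht.2.trans (min_le_left _ _))
    have ht1 : 1 ≤ 1 / t := by
      rw [le_div_iff₀ ht0, one_mul]; exact (ht.2.trans (min_le_left _ _)).trans hε₁
    have hAt := hA.pos (one_pos.trans_le ht1)
    rw [charFun_convPow, norm_pow]
    have h1 : ‖charFun P t‖ ^ j ≤ Real.exp (-(c / A (1 / t)) * j / 2) := by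
      rw [← pow_le_pow_iff_left₀ (by positivity) (Real.exp_pos _).le two_ne_zero, ← pow_mul,
        mul_comm j 2, pow_mul, ← Real.exp_nat_mul]
      have h2 : ‖charFun P t‖ ^ 2 ≤ Real.exp (-(c / A (1 / t))) := by
        have := Real.add_one_le_exp (-(c / A (1 / t)))
        linarith
      refine (pow_le_pow_left₀ (by positivity) h2 j).trans (le_of_eq ?_)
      rw [← Real.exp_nat_mul]
      congr 1
      push_cast; ring
    refine h1.trans ?_
    rw [← Real.exp_add]
    refine Real.exp_le_exp.2 ?_
    have h2 : k * a ^ β * t ^ β ≤ k + c / A (1 / t) * j / 2 := by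
      rw [mul_assoc, ← Real.mul_rpow ha.le ht0.le]
      have hnn : 0 ≤ c / A (1 / t) * j / 2 := by positivity
      rcases le_total (a * t) 1 with h | h
      · have : (a * t) ^ β ≤ 1 := Real.rpow_le_one (by positivity) h hβ0.le
        nlinarith
      · have h3 := H' (1 / t) a ht1 (by rw [div_le_iff₀ ht0]; exact h)
        rw [hAa, div_div_eq_mul_div, div_one] at h3
        have : c' * (a * t) ^ β ≤ j / A (1 / t) := by rwa [le_div_iff₀ hAt]
        calc k * (a * t) ^ β = c / 2 * (c' * (a * t) ^ β) := by rw [hk]; ring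
          _ ≤ c / 2 * (j / A (1 / t)) := by gcongr
          _ = c / A (1 / t) * j / 2 := by ring
          _ ≤ _ := by linarith
    linarith
  have hb : 0 < k * a ^ β := by positivity
  have hval := integral_exp_neg_mul_rpow hβ0 hb
  have hvp : 0 < (k * a ^ β) ^ (-1 / β) * Real.Gamma (1 / β + 1) := by positivity
  have hint : IntegrableOn (fun x : ℝ => Real.exp (-(k * a ^ β) * x ^ β)) (Ioi 0) := by
    -- The integral of a non-integrable function is 0 by convention, which contradicts the positive
    -- Gamma value.
    by_contra hni
    rw [integral_undef hni] at hval
    exact hvp.ne hval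
  have hhalf : ∫ t in (0 : ℝ)..ε, ‖charFun (convPow P j) t‖ ≤
      Real.exp k * ((k * a ^ β) ^ (-1 / β) * Real.Gamma (1 / β + 1)) := by
    rw [intervalIntegral.integral_of_le hεp.le, ← hval, ← integral_const_mul]
    refine (setIntegral_mono_on ?_ ?_ measurableSet_Ioc hpt).trans ?_
    · exact (intervalIntegrable_iff_integrableOn_Ioc_of_le hεp.le).1 intervalIntegrable_charFun.norm
    · exact (hint.mono_set Ioc_subset_Ioi_self).const_mul _
    · refine setIntegral_mono_set (hint.const_mul _) ?_ (Eventually.of_forall Ioc_subset_Ioi_self)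
      exact Eventually.of_forall fun x => by positivity
  have hfull : ∫ t in (-ε)..ε, ‖charFun (convPow P j) t‖ ≤
      2 * (Real.exp k * ((k * a ^ β) ^ (-1 / β) * Real.Gamma (1 / β + 1))) := by
    have hI : ∀ a b : ℝ, IntervalIntegrable (fun t => ‖charFun (convPow P j) t‖) volume a b :=
      fun a b => intervalIntegrable_charFun.norm
    rw [← intervalIntegral.integral_add_adjacent_intervals (hI (-ε) 0) (hI 0 ε)]
    have : ∫ t in (-ε)..0, ‖charFun (convPow P j) t‖ = ∫ t in (0 : ℝ)..ε, ‖charFun (convPow P j) t‖ := by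
      have h := intervalIntegral.integral_comp_neg (a := 0) (b := ε)
        (fun t => ‖charFun (convPow P j) t‖)
      rw [neg_zero] at h
      rw [← h]
      refine intervalIntegral.integral_congr fun t _ => ?_
      simp only [charFun_neg, RCLike.norm_conj]
    rw [this]; linarith
  have hmain := measure_Ioc_le_integral_charFun (convPow P j) hεp hεh w
  rw [← ENNReal.ofReal_toReal (measure_ne_top (convPow P j) _)]
  refine ENNReal.ofReal_le_ofReal (hmain.trans ?_)
  have e : (k * a ^ β) ^ (-1 / β) = k ^ (-1 / β) / a := by
    rw [Real.mul_rpow hk0.le (by positivity), ← Real.rpow_mul ha.le,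
      mul_div_cancel₀ _ hβ0.ne', Real.rpow_neg_one, ← div_eq_mul_inv]
  calc _ ≤ 4 / ε * (2 * (Real.exp k * ((k * a ^ β) ^ (-1 / β) * Real.Gamma (1 / β + 1)))) := by
        gcongr
    _ = C₀ / a := by rw [e, hC₀]; ring
    _ ≤ _ := by gcongr; exact le_max_left _ _

end StepLaw

/-! ### Smoothing by sums of positive steps. -/

lemma NormalizedScale.aSeq_mono {α : ℝ} {A : ℝ → ℝ} (hA : NormalizedScale α A) {m n : ℕ}
    (h : m ≤ n) : aSeq A m ≤ aSeq A n := by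
  refine hA.aSeq_le (hA.one_le_aSeq n) ?_
  rw [hA.apply_aSeq]
  exact le_trans (by exact_mod_cast h) (le_max_left _ _)

/-- `ν` smooths at scale `s` with constant `D`: the mass that `π * ν` gives to an interval of
length `h` is at most `D` times the largest mass that `π` gives to an interval of length `s`. -/
def LocBound (h : ℝ) (ν : Measure ℝ) (s : ℝ) (D : ℝ≥0∞) : Prop :=
  ∀ (π : Measure ℝ) (z : ℝ) (Θ : ℝ≥0∞), IsFiniteMeasure π → (∀ y, π (Ioc y (y + s)) ≤ Θ) →
    π.conv ν (Ioc z (z + h)) ≤ D * Θ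

namespace LocBound

variable {h s : ℝ} {ν ν' μ : Measure ℝ} {D D' : ℝ≥0∞}

lemma of_le (hs : h ≤ s) [IsFiniteMeasure ν] : LocBound h ν s (ν univ) := by
  intro π z Θ _ hΘ
  rw [Measure.conv_comm]
  exact conv_Ioc_le _ _ (fun w => (measure_mono (Ioc_subset_Ioc_right (by linarith))).trans (hΘ w)) z

lemma mono (hν : LocBound h ν s D) [SFinite ν] [SFinite ν'] (hle : ν' ≤ ν) (hD : D ≤ D') :
    LocBound h ν' s D' := by
  intro π z Θ hπ hΘ
  exact (conv_mono le_rfl hle _).trans ((hν π z Θ hπ hΘ).trans (by gcongr))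

lemma add (hν : LocBound h ν s D) (hν' : LocBound h ν' s D') [SFinite ν] [SFinite ν'] :
    LocBound h (ν + ν') s (D + D') := by
  intro π z Θ hπ hΘ
  rw [Measure.conv_add, Measure.add_apply, add_mul]
  exact add_le_add (hν π z Θ hπ hΘ) (hν' π z Θ hπ hΘ)

lemma smul_conv (hν : LocBound h ν s D) [IsFiniteMeasure ν] [IsFiniteMeasure μ] (n : ℕ) :
    LocBound h ((n : ℝ≥0∞) • μ.conv ν) s (n * μ univ * D) := by
  intro π z Θ hπ hΘ
  have : IsFiniteMeasure ((n : ℝ≥0∞) • μ.conv ν) := Measure.smul_finite _ (by simp)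
  rw [Measure.conv_comm, Measure.conv_smul_left, Measure.conv_assoc, Measure.conv_comm ν π,
    Measure.smul_apply, smul_eq_mul, mul_assoc, mul_assoc]
  gcongr
  exact conv_Ioc_le _ _ (fun w => hν π w Θ hπ hΘ) z

/-- Cut the half-line below z + h into cells of length s, numbered downwards. A point of the i-th
cell leaves at least is - h to `ν`, whence a geometric series with ratio exp(-ls) and sum at most 1
+ 1/(ls). Points above z + h contribute nothing, since `ν` does not charge the negative half-line.
-/
lemma of_exp_decay [IsFiniteMeasure ν] {E l : ℝ} (hν : ν (Iio 0) = 0) (hs : 0 < s) (hl : 0 < l)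
    (hE : 0 ≤ E) (H : ∀ w, ν (Ioc w (w + h)) ≤ ENNReal.ofReal (E * Real.exp (-(l * w)))) :
    LocBound h ν s (ENNReal.ofReal (E * Real.exp (l * h) * (1 + 1 / (l * s)))) := by
  intro π z Θ _ hΘ
  set I : ℕ → Set ℝ := fun i => Ioc (z + h - (i + 1) * s) (z + h - (i + 1) * s + s) with hI
  set c : ℕ → ℝ≥0∞ := fun i => ENNReal.ofReal (E * Real.exp (l * h) * Real.exp (-(l * s)) ^ i)
    with hc
  have hIm : ∀ i, MeasurableSet (I i) := fun i => measurableSet_Ioc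
  rw [conv_Ioc]
  have hpt : ∀ x, ν (Ioc (z - x) (z - x + h)) ≤ ∑' i, (I i).indicator (fun _ => c i) x := by
    intro x
    by_cases hx : x ≤ z + h
    · set i := ⌊(z + h - x) / s⌋₊
      have h0 : 0 ≤ (z + h - x) / s := div_nonneg (by linarith) hs.le
      have h1 : (i : ℝ) * s ≤ z + h - x := (le_div_iff₀ hs).1 (Nat.floor_le h0)
      have h2 : z + h - x < (i + 1) * s := (div_lt_iff₀ hs).1 (Nat.lt_floor_add_one _)
      have hxi : x ∈ I i := ⟨by linarith, by linarith⟩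
      refine le_trans ?_ (ENNReal.le_tsum i)
      rw [indicator_of_mem hxi]
      refine (H _).trans (ENNReal.ofReal_le_ofReal ?_)
      rw [mul_assoc, ← Real.exp_nat_mul, ← Real.exp_add]
      gcongr
      nlinarith
    · refine le_of_eq_of_le (measure_mono_null (fun y hy => ?_) hν) zero_le
      exact mem_Iio.2 (by linarith [hy.2])
  calc _ ≤ ∫⁻ x, ∑' i, (I i).indicator (fun _ => c i) x ∂π := lintegral_mono hpt
    _ = ∑' i, c i * π (I i) := by
        rw [lintegral_tsum fun i => (measurable_const.indicator (hIm i)).aemeasurable]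
        refine tsum_congr fun i => ?_
        rw [lintegral_indicator (hIm i), setLIntegral_const]
    _ ≤ ∑' i, c i * Θ := ENNReal.tsum_le_tsum fun i => by gcongr; exact hΘ _
    _ = (∑' i, c i) * Θ := ENNReal.tsum_mul_right
    _ ≤ _ := by
        gcongr
        have hls : 0 < l * s := mul_pos hl hs
        have hq0 := Real.exp_pos (-(l * s))
        have hq1 : Real.exp (-(l * s)) < 1 := Real.exp_lt_one_iff.2 (by linarith)
        rw [hc, ← ENNReal.ofReal_tsum_of_nonneg (fun i => by positivity)
          ((summable_geometric_of_lt_one hq0.le hq1).mul_left _), tsum_mul_left,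
          tsum_geometric_of_lt_one hq0.le hq1]
        refine ENNReal.ofReal_le_ofReal ?_
        gcongr
        rw [inv_le_comm₀ (by linarith) (by positivity)]
        have h1 : Real.exp (-(l * s)) ≤ (1 + l * s)⁻¹ := by
          rw [Real.exp_neg]
          gcongr
          linarith [Real.add_one_le_exp (l * s)]
        have h2 : (1 + 1 / (l * s))⁻¹ = 1 - (1 + l * s)⁻¹ := by
          field_simp; ring
        rw [h2]; linarith

end LocBound

namespace StepLaw

variable {α : ℝ} {A : ℝ → ℝ} {P : Measure ℝ} [IsProbabilityMeasure P]

/-- Split the j steps into two halves. If the sum exceeds z, one half is at least z/2, which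
Chernoff controls, and the other half supplies the local factor 1/a_{j/2}. -/
lemma truncated_local_bound (hP : StepLaw α A P) {h : ℝ} (hh : 0 < h) :
    ∃ C : ℝ, 0 < C ∧ ∀ b l : ℝ, 1 ≤ b → 0 ≤ l → ∀ (j : ℕ) (z : ℝ),
      convPow (P.restrict (Iic b)) j (Ioc z (z + h)) ≤
        ENNReal.ofReal (C / aSeq A (j / 2) *
          Real.exp (j * (C * Real.exp (2 * l * b) / A b) - l * z / 2)) := by
  obtain ⟨C₁, hC₁, H₁⟩ := hP.chernoff
  obtain ⟨C₂, hC₂, H₂⟩ := hP.concentration hh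
  have hA := hP.scale
  refine ⟨max C₁ (2 * C₂), by positivity, fun b l hb hl j z => ?_⟩
  set C := max C₁ (2 * C₂)
  have hAb := hA.pos (by linarith : 0 < b)
  set G := P.restrict (Iic b) with hG
  have hle : ∀ n, convPow G n ≤ convPow P n := fun n => convPow_mono Measure.restrict_le_self n
  set i := j / 2
  have hai := hA.aSeq_pos i
  have hij : i ≤ j - i := by omega
  have hlocal : ∀ n, i ≤ n → ∀ w, convPow G n (Ioc w (w + h)) ≤ ENNReal.ofReal (C₂ / aSeq A i) := by
    intro n hn w
    refine ((hle n _).trans (H₂ n w)).trans (ENNReal.ofReal_le_ofReal ?_)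
    have := hA.aSeq_mono hn
    gcongr
  have hexp : ∀ n, n ≤ j → convPow G n (Ici (z / 2)) ≤
      ENNReal.ofReal (Real.exp (j * (C * Real.exp (2 * l * b) / A b) - l * z / 2)) := by
    intro n hn
    refine (H₁ b l (z / 2) hb hl n).trans (ENNReal.ofReal_le_ofReal (Real.exp_le_exp.2 ?_))
    have h1 : (n : ℝ) ≤ j := by exact_mod_cast hn
    have h2 : C₁ ≤ C := le_max_left _ _
    have : (n : ℝ) * (C₁ * Real.exp (2 * l * b) / A b) ≤ j * (C * Real.exp (2 * l * b) / A b) := by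
      gcongr
    linarith
  have e : convPow G j = (convPow G i).conv (convPow G (j - i)) := by
    rw [← convPow_add]; congr 1; omega
  rw [e]
  refine (conv_Ioc_le_halves _ _ (hlocal _ hij) (hlocal i le_rfl) z).trans ?_
  set X := Real.exp (j * (C * Real.exp (2 * l * b) / A b) - l * z / 2)
  have hX : 0 < X := Real.exp_pos _
  calc _ ≤ ENNReal.ofReal X * ENNReal.ofReal (C₂ / aSeq A i) +
        ENNReal.ofReal X * ENNReal.ofReal (C₂ / aSeq A i) := by
        gcongr
        · exact hexp i (by omega)
        · exact hexp (j - i) (by omega)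
    _ = ENNReal.ofReal (2 * C₂ / aSeq A i * X) := by
        rw [← ENNReal.ofReal_mul hX.le, ← ENNReal.ofReal_add (by positivity) (by positivity)]
        congr 1; ring
    _ ≤ _ := by
        refine ENNReal.ofReal_le_ofReal ?_
        gcongr
        exact le_max_right _ _

/-- With steps truncated at a multiple of a = a_{m+1}, the local mass at w is at most of order
exp(-w/(2a))/a, so `LocBound.of_exp_decay` gives 1/a + 1/s. Longer steps are removed recursively.
The index m + 1 counts the step later singled out and keeps A(a) = m + 1 valid when m = 0. -/
lemma locBound_convPow (hP : StepLaw α A P) {h : ℝ} (hh : 0 < h) :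
    ∃ C : ℝ, 0 < C ∧ ∀ (m : ℕ) (s : ℝ), h ≤ s →
      LocBound h (convPow P m) s (ENNReal.ofReal (C * (1 / aSeq A (m + 1) + 1 / s))) := by
  have hA := hP.scale
  have hα := hA.exponent_pos
  obtain ⟨C₁, hC₁, H₁⟩ := hP.measure_Ioi_le
  obtain ⟨C₂, hC₂, H₂⟩ := hP.truncated_local_bound hh
  obtain ⟨C₃, hC₃, H₃⟩ := hA.aSeq_le_mul_aSeq 4
  obtain ⟨C₄, hC₄, H₄⟩ := hA.aSeq_le_two_pow
  obtain ⟨c, hc, Hc⟩ := hA.potter_lower (half_pos hα) (half_lt_self hα)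
  -- `s₀` is large enough that the expected number of steps above s₀a, among m + 1, is at most 1/8.
  obtain ⟨s₀, hs₀1, hs₀⟩ : ∃ s₀ : ℝ, 1 ≤ s₀ ∧ 8 * C₁ ≤ c * s₀ ^ (α / 2) := by
    have h1 : Tendsto (fun y : ℝ => c * y ^ (α / 2)) atTop atTop :=
      (tendsto_rpow_atTop (half_pos hα)).const_mul_atTop hc
    exact ((eventually_ge_atTop 1).and (h1.eventually_ge_atTop _)).exists
  set K := C₂ * Real.exp (C₂ * Real.exp (2 * s₀)) * C₃ * Real.exp h * 2 with hK
  have hK0 : 0 < K := by positivity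
  refine ⟨2 * K + 2 * C₄, by positivity, fun m s hs => ?_⟩
  have hs0 : 0 < s := hh.trans_le hs
  set a := aSeq A (m + 1) with ha
  have ha1 : 1 ≤ a := hA.one_le_aSeq _
  have ha0 : 0 < a := by linarith
  have hAa : A a = (m + 1 : ℕ) := by
    rw [ha, hA.apply_aSeq, max_eq_left]; push_cast; linarith [(Nat.cast_nonneg m : (0 : ℝ) ≤ m)]
  have hm0 : (0 : ℝ) ≤ m := m.cast_nonneg
  set b := s₀ * a with hb
  have hab : a ≤ b := le_mul_of_one_le_left ha0.le hs₀1
  have hb1 : 1 ≤ b := ha1.trans hab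
  have hAb : ((m + 1 : ℕ) : ℝ) ≤ A b := by rw [← hAa]; exact hA.le_of_le ha0 hab
  have hAb0 : 0 < A b := hA.pos (by linarith)
  set G := P.restrict (Iic b) with hG
  set H := P.restrict (Ioi b) with hH
  have hGH : P = G + H := by
    rw [hG, hH, ← compl_Iic, Measure.restrict_add_restrict_compl measurableSet_Iic]
  have hHu : ∀ n : ℕ, n ≤ m + 1 → (n : ℝ≥0∞) * H univ ≤ ENNReal.ofReal (1 / 8) := by
    intro n hn
    have h1 : H univ ≤ ENNReal.ofReal (C₁ / A b) := by
      rw [hH, Measure.restrict_apply_univ]; exact H₁ b hb1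
    calc (n : ℝ≥0∞) * H univ ≤ ((m + 1 : ℕ) : ℝ≥0∞) * ENNReal.ofReal (C₁ / A b) := by gcongr
      _ = ENNReal.ofReal ((m + 1 : ℕ) * (C₁ / A b)) := by
          rw [ENNReal.ofReal_mul (by positivity), ENNReal.ofReal_natCast]
      _ ≤ _ := by
          refine ENNReal.ofReal_le_ofReal ?_
          have h2 := Hc a b ha1 hab
          rw [hb, mul_div_cancel_right₀ _ ha0.ne', ← hb, hAa] at h2
          rw [mul_div_assoc', div_le_div_iff₀ hAb0 (by norm_num)]
          have : (0 : ℝ) ≤ (m + 1 : ℕ) := by positivity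
          nlinarith
  set g := K * (1 / a + 1 / s) with hg
  have hg0 : 0 < g := by positivity
  have hGloc : ∀ j, m / 2 ≤ j → j ≤ m → LocBound h (convPow G j) s (ENNReal.ofReal g) := by
    intro j hj1 hj2
    have haj := hA.aSeq_pos (j / 2)
    have hcmp : a ≤ C₃ * aSeq A (j / 2) := by
      refine H₃ _ _ ?_
      have : m + 1 ≤ 4 * (j / 2 + 1) := by omega
      exact_mod_cast this
    have hdec : ∀ w, convPow G j (Ioc w (w + h)) ≤
        ENNReal.ofReal (C₂ * Real.exp (C₂ * Real.exp (2 * s₀)) * C₃ / a *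
          Real.exp (-(1 / (2 * a) * w))) := by
      intro w
      refine (H₂ b (1 / a) hb1 (by positivity) j w).trans (ENNReal.ofReal_le_ofReal ?_)
      have e1 : 2 * (1 / a) * b = 2 * s₀ := by rw [hb]; field_simp
      have e2 : (j : ℝ) * (C₂ * Real.exp (2 * s₀) / A b) ≤ C₂ * Real.exp (2 * s₀) := by
        rw [mul_div_assoc', div_le_iff₀ hAb0, mul_comm]
        have : (j : ℝ) ≤ A b := le_trans (by exact_mod_cast (by omega : j ≤ m + 1)) hAb
        gcongr
      have e3 : C₂ / aSeq A (j / 2) ≤ C₂ * C₃ / a := by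
        rw [div_le_div_iff₀ haj ha0, mul_assoc]; gcongr
      rw [e1]
      calc _ ≤ C₂ * C₃ / a * Real.exp (C₂ * Real.exp (2 * s₀) - 1 / a * w / 2) := by gcongr
        _ = C₂ * C₃ / a * (Real.exp (C₂ * Real.exp (2 * s₀)) * Real.exp (-(1 / (2 * a) * w))) := by
            rw [← Real.exp_add]; congr 2; field_simp; ring
        _ = _ := by ring
    have hsupp : convPow G j (Iio 0) = 0 :=
      convPow_Iio_zero G (le_antisymm ((Measure.restrict_le_self _).trans hP.Iio_zero.le) zero_le) j
    refine (LocBound.of_exp_decay hsupp hs0 (by positivity) (by positivity) hdec).mono le_rfl ?_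
    refine ENNReal.ofReal_le_ofReal ?_
    have e4 : Real.exp (1 / (2 * a) * h) ≤ Real.exp h := by
      refine Real.exp_le_exp.2 ?_
      rw [one_div_mul_eq_div, div_le_iff₀ (by positivity)]
      nlinarith
    have e5 : 1 / a * (1 + 1 / (1 / (2 * a) * s)) ≤ 2 * (1 / a + 1 / s) := by
      have : 1 / a * (1 + 1 / (1 / (2 * a) * s)) = 1 / a + 2 * (1 / s) := by field_simp
      rw [this]
      have : 0 < 1 / a := by positivity
      linarith
    calc _ ≤ C₂ * Real.exp (C₂ * Real.exp (2 * s₀)) * C₃ / a * Real.exp h *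
          (1 + 1 / (1 / (2 * a) * s)) := by gcongr
      _ = C₂ * Real.exp (C₂ * Real.exp (2 * s₀)) * C₃ * Real.exp h *
          (1 / a * (1 + 1 / (1 / (2 * a) * s))) := by ring
      _ ≤ C₂ * Real.exp (C₂ * Real.exp (2 * s₀)) * C₃ * Real.exp h * (2 * (1 / a + 1 / s)) := by
          gcongr
      _ = g := by rw [hg, hK]; ring
  -- Adding a step turns a constant D into at most g + D/8. The recursion starts at m/2 from the
  -- trivial constant 1, so that all the scales involved are comparable to a; the initial error is
  -- reduced to 8^(-(m - m/2)), which is negligible against 1/a.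
  have hrec : ∀ i, m / 2 + i ≤ m →
      LocBound h (convPow P (m / 2 + i)) s (ENNReal.ofReal (2 * g + (1 / 8) ^ i)) := by
    intro i
    induction i with
    | zero =>
      intro _
      refine (LocBound.of_le hs).mono le_rfl ?_
      rw [measure_univ, ← ENNReal.ofReal_one]
      refine ENNReal.ofReal_le_ofReal ?_
      simp only [pow_zero]; linarith
    | succ i ih =>
      intro hi
      have h1 := ih (by omega)
      have hstep := convPow_add_measure_le G H (m / 2 + i)
      rw [← hGH] at hstep
      have hfin : IsFiniteMeasure (((m / 2 + i + 1 : ℕ) : ℝ≥0∞) • H.conv (convPow P (m / 2 + i))) :=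
        Measure.smul_finite _ (by simp)
      refine ((hGloc (m / 2 + i + 1) (by omega) hi).add (h1.smul_conv (μ := H)
        (m / 2 + i + 1))).mono hstep ?_
      calc _ ≤ ENNReal.ofReal g + ENNReal.ofReal (1 / 8) * ENNReal.ofReal (2 * g + (1 / 8) ^ i) := by
            gcongr
            exact hHu _ (by omega)
        _ = ENNReal.ofReal (g + 1 / 8 * (2 * g + (1 / 8) ^ i)) := by
            rw [← ENNReal.ofReal_mul (by norm_num), ← ENNReal.ofReal_add hg0.le (by positivity)]
        _ ≤ _ := by
            refine ENNReal.ofReal_le_ofReal ?_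
            rw [pow_succ]; linarith
  have hlast := hrec (m - m / 2) (by omega)
  rw [Nat.add_sub_cancel' (Nat.div_le_self m 2)] at hlast
  refine hlast.mono le_rfl (ENNReal.ofReal_le_ofReal ?_)
  have h8 : (1 / 8 : ℝ) ^ (m - m / 2) ≤ 2 * C₄ * (1 / a) := by
    have e1 : (1 / 8 : ℝ) ^ (m - m / 2) = (1 / 2) ^ (3 * (m - m / 2)) := by
      rw [pow_mul]; norm_num
    have e2 : (1 / 2 : ℝ) ^ (3 * (m - m / 2)) ≤ (1 / 2) ^ m :=
      pow_le_pow_of_le_one (by norm_num) (by norm_num) (by omega)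
    have e3 := H₄ (m + 1)
    rw [e1]
    refine e2.trans ?_
    rw [one_div, inv_pow, mul_one_div, inv_eq_one_div, div_le_div_iff₀ (by positivity) ha0]
    rw [pow_succ] at e3
    linarith
  have hsinv : 0 < 1 / s := by positivity
  have : 2 * C₄ * (1 / a) ≤ 2 * C₄ * (1 / a + 1 / s) := by gcongr; linarith
  calc 2 * g + (1 / 8) ^ (m - m / 2) ≤ 2 * g + 2 * C₄ * (1 / a + 1 / s) := by linarith
    _ = _ := by rw [hg]; ring

end StepLaw

/-! ### Sums in which no step is dominant. -/

/-- Put v = a_m, so that m = A(v) for m ≥ 1 and Potter gives m/A(u) ≤ C(v/u)^β with 1/(N+1) < β < α.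
Dividing the power N + 1 by v leaves (v/u)^(β(N+1)-1)/u, with a positive exponent and v/u ≤ δ. -/
lemma NormalizedScale.exists_rate {α : ℝ} {A : ℝ → ℝ} (hA : NormalizedScale α A) {N : ℕ}
    (hN : 1 < (N + 1) * α) :
    ∃ C e : ℝ, 0 < C ∧ 0 < e ∧ ∀ (m : ℕ) (δ u : ℝ), 0 < δ → δ ≤ 1 → 1 ≤ δ * u → m ≤ A (δ * u) →
      (m / A u) ^ (N + 1) / aSeq A m ≤ C * δ ^ e / u ∧ m / A u ≤ C * δ ^ e := by
  have hα := hA.exponent_pos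
  have hN0 : (0 : ℝ) < N + 1 := by positivity
  obtain ⟨β, hβ1, hβ2⟩ : ∃ β : ℝ, 1 / (N + 1) < β ∧ β < α :=
    exists_between (by rw [div_lt_iff₀ hN0]; linarith)
  have hβ0 : 0 < β := lt_trans (by positivity) hβ1
  obtain ⟨c, hc, H⟩ := hA.potter_lower hβ0 hβ2
  have he1 : 0 < β * (N + 1) - 1 := by rw [div_lt_iff₀ hN0] at hβ1; linarith
  set e := min (β * (N + 1) - 1) β with he
  have he0 : 0 < e := lt_min he1 hβ0
  refine ⟨max ((1 / c) ^ (N + 1)) (1 / c), e, by positivity, he0, ?_⟩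
  intro m δ u hδ hδ1 hδu hm
  have hu : 0 < u := by
    by_contra! h
    nlinarith
  have hu1 : 1 ≤ u := by nlinarith
  have hAu := hA.pos hu
  rcases Nat.eq_zero_or_pos m with rfl | hm0
  · have ha := hA.aSeq_pos 0
    simp only [Nat.cast_zero, zero_div]
    constructor
    · rw [zero_pow (by omega), zero_div]; positivity
    · positivity
  set v := aSeq A m with hv
  have hv1 : 1 ≤ v := hA.one_le_aSeq m
  have hv0 : 0 < v := by linarith
  have hvu : v ≤ δ * u := hA.aSeq_le hδu hm
  have hm1 : (1 : ℝ) ≤ m := by exact_mod_cast hm0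
  have hAv : A v = m := by rw [hv, hA.apply_aSeq, max_eq_left hm1]
  have hvu' : v ≤ u := hvu.trans (by nlinarith)
  have hr : v / u ≤ δ := by rwa [div_le_iff₀ hu]
  have hr0 : 0 < v / u := by positivity
  have hr1 : v / u ≤ 1 := hr.trans hδ1
  have key : (m : ℝ) / A u ≤ 1 / c * (v / u) ^ β := by
    have h1 := H v u hv1 hvu'
    rw [hAv] at h1
    have h2 : (u / v) ^ β = ((v / u) ^ β)⁻¹ := by
      rw [← Real.inv_rpow hr0.le, inv_div]
    rw [h2] at h1
    have hp : 0 < (v / u) ^ β := by positivity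
    rw [div_le_iff₀ hAu]
    calc (m : ℝ) = 1 / c * (v / u) ^ β * (c * ((v / u) ^ β)⁻¹ * m) := by field_simp
      _ ≤ 1 / c * (v / u) ^ β * A u := by gcongr
  have hpow : ∀ x, e ≤ x → (v / u) ^ x ≤ δ ^ e := fun x hx =>
    (Real.rpow_le_rpow_of_exponent_ge hr0 hr1 hx).trans (Real.rpow_le_rpow hr0.le hr he0.le)
  constructor
  · have h1 : ((v / u) ^ β) ^ (N + 1) / v = (v / u) ^ (β * (N + 1) - 1) / u := by
      rw [← Real.rpow_natCast, ← Real.rpow_mul hr0.le, Real.rpow_sub hr0, Real.rpow_one]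
      push_cast
      field_simp
    calc (m / A u) ^ (N + 1) / v ≤ (1 / c * (v / u) ^ β) ^ (N + 1) / v := by gcongr
      _ = (1 / c) ^ (N + 1) * (((v / u) ^ β) ^ (N + 1) / v) := by rw [mul_pow]; ring
      _ = (1 / c) ^ (N + 1) * (v / u) ^ (β * (N + 1) - 1) / u := by rw [h1]; ring
      _ ≤ _ := by
          gcongr
          · exact le_max_left _ _
          · exact hpow _ (min_le_left _ _)
  · refine key.trans ?_
    gcongr
    · exact le_max_right _ _
    · exact hpow _ (min_le_right _ _)

namespace StepLaw

variable {α : ℝ} {A : ℝ → ℝ} {P : Measure ℝ} [IsProbabilityMeasure P]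

/-- Steps in (εu/(4(N+1)), c'u/N] are peeled off one at a time, each at cost q of order m/A(u).
After N of them the remaining target is still at least εu, with ε = c - c'. Small steps reach it
only with the Chernoff cost (m/A(u))^(N+1)/a_m, while an (N+1)-st peeling already yields q^(N+1),
and concentration adds 1/a_m. -/
lemma convPow_truncated_le (hP : StepLaw α A P) {h : ℝ} (hh : 0 < h) {N : ℕ} (hN : 0 < N)
    {c c' : ℝ} (hc' : 0 < c') (hcc : c' < c) (hc1 : c ≤ 1) :
    ∃ C u₀ : ℝ, 0 < C ∧ 1 ≤ u₀ ∧ ∀ (u z : ℝ) (m : ℕ), u₀ ≤ u → c * u ≤ z →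
      convPow (P.restrict (Iic (c' * u / N))) m (Ioc z (z + h)) ≤
        ENNReal.ofReal (C * ((m / A u) ^ (N + 1) / aSeq A m)) := by
  have hA := hP.scale
  have hα1 := hA.exponent_lt_one
  obtain ⟨C₁, hC₁, H₁⟩ := hP.measure_Ioi_le
  obtain ⟨C₂, hC₂, H₂⟩ := hP.truncated_local_bound hh
  obtain ⟨C₃, hC₃, H₃⟩ := hA.aSeq_le_mul_aSeq (N + 2)
  obtain ⟨C₄, hC₄, H₄⟩ := hP.concentration hh
  obtain ⟨C₅, hC₅, H₅⟩ := hA.potter_upper hα1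
  have hN0 : (0 : ℝ) < N := by exact_mod_cast hN
  set ε := c - c' with hε
  have hε0 : 0 < ε := by linarith
  set ε₁ := ε / (4 * (N + 1)) with hε₁
  have hε₁0 : 0 < ε₁ := by positivity
  have hε₁1 : ε₁ ≤ 1 := by
    rw [hε₁, div_le_one (by positivity)]; nlinarith
  set B := (∑ i ∈ Finset.range (N + 1), C₁ ^ i) * (C₂ * C₃ * Real.exp C₂) +
    C₁ ^ (N + 1) * (C₄ * C₃) + C₄ with hB
  have hB0 : 0 < B := by positivity
  refine ⟨B * (C₅ * (1 / ε₁)) ^ (N + 1), 1 / ε₁, by positivity, ?_, ?_⟩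
  · rw [le_div_iff₀ hε₁0]; linarith
  intro u z m hu hz
  set b := ε₁ * u with hb
  have hb1 : 1 ≤ b := by rw [div_le_iff₀ hε₁0] at hu; linarith
  have hu0 : 0 < u := lt_of_lt_of_le (by positivity) hu
  have hbu : b ≤ u := by nlinarith
  have hb0 : 0 < b := by linarith
  have hAb := hA.pos hb0
  have hAu := hA.pos hu0
  have ham := hA.aSeq_pos m
  set Pb := P.restrict (Iic (c' * u / N)) with hPb
  have hPbP : Pb ≤ P := Measure.restrict_le_self
  suffices hmain : convPow Pb m (Ioc z (z + h)) ≤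
      ENNReal.ofReal (B * ((m / A b) ^ (N + 1) / aSeq A m)) by
    refine hmain.trans (ENNReal.ofReal_le_ofReal ?_)
    have h1 : 1 / A b ≤ C₅ * (1 / ε₁) * (1 / A u) := by
      have h2 := H₅ b u hb1 hbu
      have e : u / b = 1 / ε₁ := by rw [hb]; field_simp
      rw [Real.rpow_one, e] at h2
      rw [mul_one_div, div_le_div_iff₀ hAb hAu, one_mul]
      exact h2
    calc B * ((m / A b) ^ (N + 1) / aSeq A m)
        = B * ((m * (1 / A b)) ^ (N + 1) / aSeq A m) := by rw [mul_one_div]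
      _ ≤ B * ((m * (C₅ * (1 / ε₁) * (1 / A u))) ^ (N + 1) / aSeq A m) := by gcongr
      _ = _ := by
          rw [show (m : ℝ) * (C₅ * (1 / ε₁) * (1 / A u)) = C₅ * (1 / ε₁) * (m / A u) by ring,
            mul_pow]; ring
  have hX0 : (0 : ℝ) ≤ (m / A b) ^ (N + 1) / aSeq A m := by positivity
  -- When m > A(b) the factor (m/A(b))^(N+1) exceeds 1, so concentration alone suffices.
  by_cases hmb : A b < m
  · refine (convPow_mono hPbP m _).trans ((H₄ m z).trans (ENNReal.ofReal_le_ofReal ?_))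
    have h1 : 1 ≤ (m / A b) ^ (N + 1) := one_le_pow₀ (by rw [le_div_iff₀ hAb]; linarith)
    have h2 : C₄ ≤ B := by rw [hB]; exact le_add_of_nonneg_left (by positivity)
    calc C₄ / aSeq A m ≤ B * ((m / A b) ^ (N + 1)) / aSeq A m := by
          gcongr
          nlinarith
      _ = _ := by ring
  push Not at hmb
  rcases Nat.eq_zero_or_pos m with rfl | hm0
  · have hz0 : 0 < z := lt_of_lt_of_le (mul_pos (by linarith) hu0) hz
    have : convPow Pb 0 (Ioc z (z + h)) = 0 := by
      rw [convPow, Measure.dirac_apply' _ measurableSet_Ioc, indicator_of_notMem]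
      exact fun h => absurd h.1 (not_lt.2 hz0.le)
    rw [this]; exact zero_le
  have hm1 : (0 : ℝ) < m := by exact_mod_cast hm0
  set b' := c' * u / N with hb'
  have hb'0 : 0 < b' := by positivity
  set G := Pb.restrict (Iic b) with hG
  set H := Pb.restrict (Ioi b) with hH
  have hGH : Pb = G + H := by
    rw [hG, hH, ← compl_Iic, Measure.restrict_add_restrict_compl measurableSet_Iic]
  set q := m * (C₁ / A b) with hq
  have hq0 : 0 < q := by positivity
  have hqC : q ≤ C₁ := by
    rw [hq, mul_div_assoc', div_le_iff₀ hAb, mul_comm]; gcongr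
  set Q := C₄ * C₃ / aSeq A m with hQ
  have hQ0 : 0 < Q := by positivity
  set g := C₂ * C₃ * Real.exp C₂ * ((m / A b) ^ (N + 1) / aSeq A m) with hg
  have hg0 : 0 < g := by positivity
  have hHu : ∀ j : ℕ, j ≤ m → (j : ℝ≥0∞) * H univ ≤ ENNReal.ofReal q := by
    intro j hj
    have h1 : H univ ≤ ENNReal.ofReal (C₁ / A b) := by
      rw [hH, Measure.restrict_apply_univ]; exact (hPbP _).trans (H₁ b hb1)
    calc (j : ℝ≥0∞) * H univ ≤ (m : ℝ≥0∞) * ENNReal.ofReal (C₁ / A b) := by gcongr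
      _ = _ := by
          rw [hq, ENNReal.ofReal_mul (by positivity), ENNReal.ofReal_natCast]
  have hcmp : ∀ j i : ℕ, m ≤ j + (N + 1) → j ≤ 2 * i + 1 → 1 / aSeq A i ≤ C₃ / aSeq A m := by
    intro j i h1 h2
    have : (m : ℝ) ≤ (N + 2) * (i + 1) := by
      have h3 : m ≤ 2 * i + (N + 2) := by omega
      have h4 : 2 * i ≤ (N + 2) * i := by gcongr; omega
      have h5 : m ≤ (N + 2) * (i + 1) := by rw [mul_add]; omega
      exact_mod_cast h5
    rw [div_le_div_iff₀ (hA.aSeq_pos _) ham, one_mul]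
    exact H₃ _ _ this
  have hGle : G ≤ P.restrict (Iic b) := Measure.restrict_mono_measure hPbP _
  have hGb : ∀ j, m ≤ j + (N + 1) → j ≤ m → ∀ w, ε * u ≤ w →
      convPow G j (Ioc w (w + h)) ≤ ENNReal.ofReal g := by
    intro j hj1 hj2 w hw
    -- This `l` makes exp(2lb) = A(b)/m, so the Chernoff exponent stays at most C₂, while lw/2 ≥
    -- (N+1) log(A(b)/m) by the choice of ε₁. The tail factor is then exactly (m/A(b))^(N+1).
    set l := Real.log (A b / m) / (2 * b) with hl
    have hmA : 1 ≤ A b / m := by rw [le_div_iff₀ hm1]; linarith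
    have hlog : 0 ≤ Real.log (A b / m) := Real.log_nonneg hmA
    have hl0 : 0 ≤ l := by positivity
    refine (convPow_mono hGle j _).trans ((H₂ b l hb1 hl0 j w).trans
      (ENNReal.ofReal_le_ofReal ?_))
    have e1 : 2 * l * b = Real.log (A b / m) := by rw [hl]; field_simp
    have e2 : (j : ℝ) * (C₂ * Real.exp (2 * l * b) / A b) ≤ C₂ := by
      rw [e1, Real.exp_log (by positivity)]
      have : (j : ℝ) ≤ m := by exact_mod_cast hj2
      calc (j : ℝ) * (C₂ * (A b / m) / A b) = C₂ * (j / m) := by field_simp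
        _ ≤ C₂ * 1 := by gcongr; rw [div_le_one hm1]; exact this
        _ = C₂ := mul_one _
    have e3 : ((N + 1 : ℕ) : ℝ) * Real.log (A b / m) ≤ l * w / 2 := by
      have : l * (ε * u) / 2 ≤ l * w / 2 := by gcongr
      refine le_trans (le_of_eq ?_) this
      rw [hl, hb, hε₁]; push_cast; field_simp; ring
    have e4 : Real.exp (-(((N + 1 : ℕ) : ℝ) * Real.log (A b / m))) = (m / A b) ^ (N + 1) := by
      rw [Real.exp_neg, Real.exp_nat_mul, Real.exp_log (by positivity), ← inv_pow, inv_div]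
    have e5 := hcmp j (j / 2) hj1 (by omega)
    calc _ ≤ C₂ / aSeq A (j / 2) *
          Real.exp (C₂ + -(((N + 1 : ℕ) : ℝ) * Real.log (A b / m))) := by
          have := hA.aSeq_pos (j / 2)
          gcongr; linarith
      _ = C₂ * (1 / aSeq A (j / 2)) * (Real.exp C₂ * (m / A b) ^ (N + 1)) := by
          rw [Real.exp_add, e4]; ring
      _ ≤ C₂ * (C₃ / aSeq A m) * (Real.exp C₂ * (m / A b) ^ (N + 1)) := by gcongr
      _ = g := by rw [hg]; ring
  -- `k` is the number of peelings still allowed. At most N + 1 steps are lost in all, so a_j stays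
  -- comparable to a_m. At k = 0 the position of the target no longer matters.
  have hind : ∀ k, k ≤ N + 1 → ∀ j, m ≤ j + (N + 1 - k) → j ≤ m →
      ∀ w, ε * u + ((k : ℝ) - 1) * b' ≤ w → convPow Pb j (Ioc w (w + h)) ≤
        ENNReal.ofReal ((∑ i ∈ Finset.range k, q ^ i) * g + q ^ k * Q) := by
    intro k
    induction k with
    | zero =>
      intro _ j hj1 hj2 w _
      refine (convPow_mono hPbP j _).trans ((H₄ j w).trans (ENNReal.ofReal_le_ofReal ?_))
      have e5 := hcmp j j hj1 (by omega)
      simp only [Finset.range_zero, Finset.sum_empty, zero_mul, pow_zero, one_mul, zero_add]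
      calc C₄ / aSeq A j = C₄ * (1 / aSeq A j) := by ring
        _ ≤ C₄ * (C₃ / aSeq A m) := by gcongr
        _ = Q := by rw [hQ]; ring
    | succ k ih =>
      intro hk j hj1 hj2 w hw
      push_cast at hw
      have hwε : ε * u ≤ w := by
        have : 0 ≤ (k : ℝ) * b' := by positivity
        linarith
      have hS0 : 0 ≤ (∑ i ∈ Finset.range k, q ^ i) * g + q ^ k * Q :=
        add_nonneg (mul_nonneg (Finset.sum_nonneg fun i _ => pow_nonneg hq0.le i) hg0.le)
          (mul_nonneg (pow_nonneg hq0.le k) hQ0.le)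
      have hsum : (∑ i ∈ Finset.range (k + 1), q ^ i) * g + q ^ (k + 1) * Q =
          g + q * ((∑ i ∈ Finset.range k, q ^ i) * g + q ^ k * Q) := by
        rw [Finset.sum_range_succ']
        simp_rw [pow_succ, ← Finset.sum_mul]
        ring
      rw [hsum]
      rcases j with _ | j
      · refine (hGb 0 (by omega) hj2 w hwε).trans (ENNReal.ofReal_le_ofReal ?_)
        have := mul_nonneg hq0.le hS0
        linarith
      · have hstep := convPow_add_measure_le G H j (Ioc w (w + h))
        rw [← hGH, Measure.add_apply, Measure.smul_apply, smul_eq_mul] at hstep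
        refine hstep.trans ?_
        rw [ENNReal.ofReal_add hg0.le (mul_nonneg hq0.le hS0), ENNReal.ofReal_mul hq0.le]
        refine add_le_add (hGb _ (by omega) hj2 w hwε) ?_
        have h1 : H.conv (convPow Pb j) (Ioc w (w + h)) ≤ H univ *
            ENNReal.ofReal ((∑ i ∈ Finset.range k, q ^ i) * g + q ^ k * Q) := by
          rw [conv_Ioc, mul_comm, ← lintegral_const]
          refine lintegral_mono_ae ?_
          have hae : ∀ᵐ x ∂H, x ≤ b' :=
            ae_mono (Measure.restrict_le_self) (ae_restrict_mem measurableSet_Iic)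
          filter_upwards [hae] with x hx
          exact ih (by omega) j (by omega) (by omega) (w - x) (by linarith)
        calc _ ≤ ((j + 1 : ℕ) : ℝ≥0∞) * (H univ *
              ENNReal.ofReal ((∑ i ∈ Finset.range k, q ^ i) * g + q ^ k * Q)) := by gcongr
          _ = ((j + 1 : ℕ) : ℝ≥0∞) * H univ *
              ENNReal.ofReal ((∑ i ∈ Finset.range k, q ^ i) * g + q ^ k * Q) := by ring
          _ ≤ _ := by gcongr; exact hHu _ hj2
  have hfin := hind (N + 1) le_rfl m (by omega) le_rfl z (by
    push_cast
    have : (N : ℝ) * b' = c' * u := by rw [hb']; field_simp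
    rw [add_sub_cancel_right, this, hε]; linarith)
  refine hfin.trans (ENNReal.ofReal_le_ofReal ?_)
  have e6 : q ^ (N + 1) * Q = C₁ ^ (N + 1) * (C₄ * C₃) * ((m / A b) ^ (N + 1) / aSeq A m) := by
    rw [hq, hQ, show (m : ℝ) * (C₁ / A b) = C₁ * (m / A b) by ring, mul_pow]; ring
  have e7 : ∑ i ∈ Finset.range (N + 1), q ^ i ≤ ∑ i ∈ Finset.range (N + 1), C₁ ^ i :=
    Finset.sum_le_sum fun i _ => pow_le_pow_left₀ hq0.le hqC i
  calc _ ≤ (∑ i ∈ Finset.range (N + 1), C₁ ^ i) * g + q ^ (N + 1) * Q := by gcongr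
    _ = ((∑ i ∈ Finset.range (N + 1), C₁ ^ i) * (C₂ * C₃ * Real.exp C₂) +
        C₁ ^ (N + 1) * (C₄ * C₃)) * ((m / A b) ^ (N + 1) / aSeq A m) := by rw [e6, hg]; ring
    _ ≤ _ := by
        gcongr
        rw [hB]; linarith

end StepLaw

/-! ### Regular variation on macroscopic intervals. -/

lemma tail_antitone (P : Measure ℝ) [IsFiniteMeasure P] : Antitone (tail P) := fun _ _ h =>
  measureReal_mono (Ioi_subset_Ioi h)

lemma measureReal_Ioc_eq_tail_sub (P : Measure ℝ) [IsFiniteMeasure P] {x y : ℝ} (h : x ≤ y) :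
    P.real (Ioc x y) = tail P x - tail P y := by
  rw [tail, tail, ← measureReal_sdiff (Ioi_subset_Ioi h) measurableSet_Ioi]
  congr 1
  ext z; simp

lemma rpow_neg_sub_le {α γ v d : ℝ} (hα : 0 < α) (hγ : 0 < γ) (hv : γ ≤ v) (hd : 0 ≤ d) :
    v ^ (-α) - (v + d) ^ (-α) ≤ α * γ ^ (-α) / γ * d := by
  have hv0 : 0 < v := by linarith
  have h1 : (v + d) ^ (-α) = v ^ (-α) * (1 + d / v) ^ (-α) := by
    rw [← Real.mul_rpow hv0.le (by positivity)]
    congr 1; field_simp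
  have h2 : 1 - α * (d / v) ≤ (1 + d / v) ^ (-α) := by
    rw [Real.rpow_def_of_pos (by positivity)]
    have h3 := Real.add_one_le_exp (Real.log (1 + d / v) * -α)
    have h4 := Real.log_le_sub_one_of_pos (by positivity : 0 < 1 + d / v)
    nlinarith
  have h5 : v ^ (-α) ≤ γ ^ (-α) := Real.rpow_le_rpow_of_nonpos hγ hv (by linarith)
  have h6 : 0 < v ^ (-α) := by positivity
  calc v ^ (-α) - (v + d) ^ (-α) ≤ v ^ (-α) * (α * (d / v)) := by rw [h1]; nlinarith
    _ ≤ γ ^ (-α) * (α * (d / γ)) := by gcongr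
    _ = _ := by ring

namespace StepLaw

variable {α : ℝ} {A : ℝ → ℝ} {P : Measure ℝ} [IsProbabilityMeasure P]

/-- On a grid of mesh du, regular variation replaces the tail by v^(-α), which is Lipschitz on [γ,
∞). Only the threshold u₀ depends on d; the constant C does not, and `convPow_truncated_le_rate`
relies on this. -/
lemma measure_Ioc_le_of_macroscopic (hP : StepLaw α A P) {γ : ℝ} (hγ : 0 < γ) :
    ∃ C : ℝ, 0 < C ∧ ∀ d : ℝ, 0 < d → ∃ u₀ : ℝ, 1 ≤ u₀ ∧ ∀ u s y : ℝ, u₀ ≤ u → d * u ≤ s →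
      γ * u ≤ y → P (Ioc y (y + s)) ≤ ENNReal.ofReal (C * (s / u) / A u) := by
  have hα := hP.scale.exponent_pos
  obtain ⟨C₁, hC₁, H₁⟩ := hP.tail_le
  set M := α * γ ^ (-α) / γ + 2 with hM
  have hM0 : 0 < M := by positivity
  refine ⟨3 * M * C₁, by positivity, fun d hd => ?_⟩
  -- Beyond the J-th grid point the whole remaining tail is of order d, so convergence is needed at
  -- finitely many points only.
  obtain ⟨J, hJ⟩ : ∃ J : ℕ, (γ + J * d) ^ (-α) < d := by
    have h1 : Tendsto (fun j : ℕ => γ + (j : ℝ) * d) atTop atTop :=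
      tendsto_atTop_add_const_left _ _ (tendsto_natCast_atTop_atTop.atTop_mul_const hd)
    have h2 := (tendsto_rpow_neg_atTop hα).comp h1
    exact (h2.eventually (gt_mem_nhds hd)).exists
  have hev : ∀ᶠ u in atTop, ∀ j ∈ Finset.range (J + 1),
      |tail P ((γ + j * d) * u) / tail P u - (γ + j * d) ^ (-α)| < d / 2 := by
    rw [eventually_all_finset]
    intro j _
    have := (hP.regular (γ + j * d) (by positivity)).sub_const ((γ + j * d) ^ (-α))
    rw [sub_self] at this
    have h2 := this.abs
    rw [abs_zero] at h2
    exact h2.eventually (gt_mem_nhds (half_pos hd))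
  obtain ⟨u₁, hu₁⟩ := eventually_atTop.1 hev
  refine ⟨max u₁ 1, le_max_right _ _, fun u s y hu hs hy => ?_⟩
  have hu1 : 1 ≤ u := (le_max_right _ _).trans hu
  have hu0 : 0 < u := by linarith
  have hAu := hP.scale.pos hu0
  have hH := hu₁ u ((le_max_left _ _).trans hu)
  have htu := hP.tail_pos u
  set f : ℕ → ℝ := fun j => tail P ((γ + j * d) * u) with hf
  have hf0 : ∀ j, 0 ≤ f j := fun j => (hP.tail_pos _).le
  have hfJ : ∀ j ∈ Finset.range (J + 1), |f j - (γ + j * d) ^ (-α) * tail P u| ≤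
      d / 2 * tail P u := by
    intro j hj
    have h1 := (hH j hj).le
    have e : f j - (γ + j * d) ^ (-α) * tail P u =
        (f j / tail P u - (γ + j * d) ^ (-α)) * tail P u := by field_simp
    rw [e, abs_mul, abs_of_pos htu]
    gcongr
  have hcell : ∀ j, f j - f (j + 1) ≤ M * d * tail P u := by
    intro j
    rcases lt_or_ge j J with hj | hj
    · have h1 := abs_le.1 (hfJ j (by simp; omega))
      have h2 := abs_le.1 (hfJ (j + 1) (by simp; omega))
      have h3 := rpow_neg_sub_le (v := γ + j * d) hα hγ (by
        have : 0 ≤ (j : ℝ) * d := by positivity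
        linarith) hd.le
      have e : γ + ((j + 1 : ℕ) : ℝ) * d = γ + j * d + d := by push_cast; ring
      rw [e] at h2
      have h4 := mul_le_mul_of_nonneg_right h3 htu.le
      have : M * d * tail P u = α * γ ^ (-α) / γ * d * tail P u + 2 * d * tail P u := by
        rw [hM]; ring
      have h5 : 0 < d * tail P u := by positivity
      rw [this]
      nlinarith [h1.2, h2.1]
    · have h1 := abs_le.1 (hfJ J (by simp))
      have h2 : f j ≤ f J := by
        refine tail_antitone P ?_
        have : (J : ℝ) ≤ j := by exact_mod_cast hj
        gcongr
      have h3 := hf0 (j + 1)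
      have h4 : 0 < d * tail P u := by positivity
      have h5 := mul_lt_mul_of_pos_right hJ htu
      have h6 : 2 * (d * tail P u) ≤ M * (d * tail P u) := by
        gcongr; rw [hM]; exact le_add_of_nonneg_left (by positivity)
      nlinarith [h1.2]
  have hcells : ∀ k j : ℕ, f j - f (j + k) ≤ k * (M * d * tail P u) := by
    intro k
    induction k with
    | zero => intro j; simp
    | succ k ih =>
      intro j
      have h1 := ih j
      have h2 := hcell (j + k)
      rw [← add_assoc]; push_cast; linarith
  have hdu : 0 < d * u := by positivity
  set j := ⌊(y - γ * u) / (d * u)⌋₊ with hj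
  set k := ⌈s / (d * u)⌉₊ with hk
  have hj1 : (j : ℝ) * (d * u) ≤ y - γ * u :=
    (le_div_iff₀ hdu).1 (Nat.floor_le (div_nonneg (by linarith) hdu.le))
  have hj2 : y - γ * u < (j + 1) * (d * u) := (div_lt_iff₀ hdu).1 (Nat.lt_floor_add_one _)
  have hk1 : s ≤ k * (d * u) := (div_le_iff₀ hdu).1 (Nat.le_ceil _)
  have hs0 : 0 < s := hdu.trans_le hs
  have hk2 : (k : ℝ) < s / (d * u) + 1 := Nat.ceil_lt_add_one (by positivity)
  have h1s : 1 ≤ s / (d * u) := by rwa [le_div_iff₀ hdu, one_mul]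
  have hfin : P.real (Ioc y (y + s)) ≤ ((k + 1 : ℕ) : ℝ) * (M * d * tail P u) := by
    rw [measureReal_Ioc_eq_tail_sub P (by linarith)]
    have h1 : tail P y ≤ f j := tail_antitone P (by linarith)
    have h2 : f (j + (k + 1)) ≤ tail P (y + s) := by
      refine tail_antitone P ?_
      push_cast; linarith
    linarith [hcells (k + 1) j]
  rw [← ENNReal.ofReal_toReal (measure_ne_top P (Ioc y (y + s)))]
  refine ENNReal.ofReal_le_ofReal (hfin.trans ?_)
  have h2 := H₁ u hu1
  calc ((k + 1 : ℕ) : ℝ) * (M * d * tail P u) ≤ (3 * (s / (d * u))) * (M * d * (C₁ / A u)) := by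
        gcongr
        push_cast; linarith
    _ = _ := by field_simp

end StepLaw

/-! ### The positive part of F as a step law. -/

/-- The law of a step conditioned to be strictly positive. -/
def posLaw (F : Measure ℝ) : Measure ℝ := (F (Ioi 0))⁻¹ • F.restrict (Ioi 0)

lemma posLaw_apply_le (F : Measure ℝ) (s : Set ℝ) : posLaw F s ≤ (F (Ioi 0))⁻¹ * F s := by
  rw [posLaw, Measure.smul_apply, smul_eq_mul]
  gcongr
  exact Measure.restrict_le_self

lemma isProbabilityMeasure_posLaw {F : Measure ℝ} [IsFiniteMeasure F] (h : F (Ioi 0) ≠ 0) :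
    IsProbabilityMeasure (posLaw F) := by
  refine ⟨?_⟩
  rw [posLaw, Measure.smul_apply, smul_eq_mul, Measure.restrict_apply_univ]
  exact ENNReal.inv_mul_cancel h (measure_ne_top _ _)

lemma tail_posLaw (F : Measure ℝ) [IsFiniteMeasure F] {x : ℝ} (hx : 0 ≤ x) :
    tail (posLaw F) x = tail F x / tail F 0 := by
  have : Ioi x ∩ Ioi 0 = Ioi x := inter_eq_left.2 (Ioi_subset_Ioi hx)
  rw [tail, tail, tail, posLaw, measureReal_def, Measure.smul_apply, smul_eq_mul,
    Measure.restrict_apply measurableSet_Ioi, this, ENNReal.toReal_mul, ENNReal.toReal_inv,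
    ← measureReal_def, ← measureReal_def]
  field_simp

section Hypotheses

variable {α : ℝ} {A : ℝ → ℝ} {F : Measure ℝ}

lemma tendsto_tail_mul (hA : NormalizedScale α A) (htail : tail F ~[atTop] fun x => 1 / A x) :
    Tendsto (fun x => tail F x * A x) atTop (𝓝 1) := by
  have hne : ∀ᶠ x in atTop, 1 / A x ≠ 0 := by
    filter_upwards [eventually_gt_atTop 0] with x hx
    exact (one_div_pos.2 (hA.pos hx)).ne'
  have := (isEquivalent_iff_tendsto_one hne).1 htail
  refine this.congr' ?_
  filter_upwards with x
  simp [div_eq_mul_inv]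

variable [IsProbabilityMeasure F]

lemma tail_pos (hA : NormalizedScale α A) (htail : tail F ~[atTop] fun x => 1 / A x) (x : ℝ) :
    0 < tail F x := by
  have h1 := (tendsto_tail_mul hA htail).eventually (lt_mem_nhds one_pos)
  obtain ⟨y, hy1, hy2, hy3⟩ := (h1.and ((eventually_ge_atTop x).and (eventually_gt_atTop 0))).exists
  refine tail_pos_of_le F hy2 ?_
  exact pos_of_mul_pos_left hy1 (hA.pos hy3).le

lemma tendsto_tail_div (hA : NormalizedScale α A) (htail : tail F ~[atTop] fun x => 1 / A x)
    {c : ℝ} (hc : 0 < c) : Tendsto (fun x => tail F (c * x) / tail F x) atTop (𝓝 (c ^ (-α))) := by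
  have h1 := tendsto_tail_mul hA htail
  have h2 := h1.comp (tendsto_id.const_mul_atTop hc)
  have h3 := (h2.div h1 one_ne_zero).mul
    ((hA.regular.tendsto c hc).inv₀ (Real.rpow_pos_of_pos hc α).ne')
  rw [div_one, one_mul, ← Real.rpow_neg hc.le] at h3
  refine h3.congr' ?_
  filter_upwards [eventually_gt_atTop 0] with x hx
  have ha := hA.pos hx
  have hb := hA.pos (mul_pos hc hx)
  have ht := tail_pos hA htail x
  simp only [Function.comp, id, Pi.div_apply]
  field_simp

lemma stepLaw_posLaw (hA : NormalizedScale α A) (htail : tail F ~[atTop] fun x => 1 / A x) :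
    StepLaw α A (posLaw F) := by
  have hp := tail_pos hA htail 0
  have hp1 : tail F 0 ≤ 1 := measureReal_le_one
  have h1 := tendsto_tail_mul hA htail
  obtain ⟨x₀, hx₀⟩ := eventually_atTop.1 ((h1.eventually (lt_mem_nhds one_half_lt_one)).and
    (h1.eventually (gt_mem_nhds one_lt_two)))
  set x₁ := max x₀ 1
  have hx₁ : 1 ≤ x₁ := le_max_right _ _
  have hAx := hA.one_le hx₁
  have ht₁ := tail_pos hA htail x₁
  refine ⟨hA, ?_, ⟨min (1 / 2) (tail F x₁), by positivity, fun x hx => ?_⟩,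
    ⟨max 2 (A x₁) / tail F 0, by positivity, fun x hx => ?_⟩, fun c hc => ?_⟩
  · rw [posLaw, Measure.smul_apply, Measure.restrict_apply measurableSet_Iic, Iic_inter_Ioi,
      Ioc_self, measure_empty, smul_zero]
  · have hx0 : 0 < x := by linarith
    have ha := hA.one_le hx
    have ha0 := hA.pos hx0
    rw [tail_posLaw F hx0.le]
    have hle : tail F x ≤ tail F x / tail F 0 := by
      rw [le_div_iff₀ hp]
      have := (tail_pos hA htail x).le
      nlinarith
    refine le_trans ?_ hle
    rw [div_le_iff₀ ha0]
    rcases le_total x x₁ with h | h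
    · have h2 := tail_antitone F h
      have h3 : min (1 / 2) (tail F x₁) ≤ tail F x₁ := min_le_right _ _
      nlinarith
    · exact (min_le_left _ _).trans (hx₀ x ((le_max_left _ _).trans h)).1.le
  · have hx0 : 0 < x := by linarith
    have ha0 := hA.pos hx0
    rw [tail_posLaw F hx0.le, div_right_comm]
    gcongr
    rw [le_div_iff₀ ha0]
    rcases le_total x x₁ with h | h
    · have h2 : tail F x ≤ 1 := measureReal_le_one
      have h3 : A x ≤ A x₁ := hA.le_of_le hx0 h
      have h4 : A x₁ ≤ max 2 (A x₁) := le_max_right _ _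
      nlinarith
    · exact (hx₀ x ((le_max_left _ _).trans h)).2.le.trans (le_max_left _ _)
  · refine (tendsto_tail_div hA htail hc).congr' ?_
    filter_upwards [eventually_gt_atTop 0] with x hx
    rw [tail_posLaw F hx.le, tail_posLaw F (mul_pos hc hx).le, div_div_div_cancel_right₀ hp.ne']

end Hypotheses

/-! ### From interval masses to the overflow integral. -/

/-- By Fubini, each x in (y₁, y₂] is covered by y + (0, h] for a set of y of length h, contained in
(y₁ - h, y₂] up to a null set. -/
lemma measure_Ioc_le_lintegral (F : Measure ℝ) [SFinite F] (h y₁ y₂ : ℝ) :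
    ENNReal.ofReal h * F (Ioc y₁ y₂) ≤ ∫⁻ y in Ioc (y₁ - h) y₂, F (Ioc y (y + h)) := by
  have hm : MeasurableSet {p : ℝ × ℝ | p.1 < p.2 ∧ p.2 ≤ p.1 + h} :=
    (measurableSet_lt measurable_fst measurable_snd).inter
      (measurableSet_le measurable_snd (measurable_fst.add_const h))
  set S := {p : ℝ × ℝ | p.1 < p.2 ∧ p.2 ≤ p.1 + h} with hS
  have e1 : ∀ y, F (Ioc y (y + h)) = ∫⁻ x, S.indicator 1 (y, x) ∂F := by
    intro y
    rw [← lintegral_indicator_one measurableSet_Ioc]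
    rfl
  simp_rw [e1]
  have hae : AEMeasurable (Function.uncurry fun y x : ℝ => S.indicator (1 : ℝ × ℝ → ℝ≥0∞) (y, x))
      ((volume.restrict (Ioc (y₁ - h) y₂)).prod F) := (measurable_one.indicator hm).aemeasurable
  rw [lintegral_lintegral_swap hae, ← setLIntegral_const]
  refine le_trans ?_ (lintegral_mono' (Measure.restrict_le_self (s := Ioc y₁ y₂)) le_rfl)
  · refine setLIntegral_mono' measurableSet_Ioc fun x hx => ?_
    have h1 : volume (Ico (x - h) x) = ENNReal.ofReal h := by rw [Real.volume_Ico]; congr 1; ring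
    rw [← h1, ← lintegral_indicator_one measurableSet_Ico,
      ← lintegral_indicator measurableSet_Ioc]
    refine lintegral_mono fun y => ?_
    by_cases hy : y ∈ Ico (x - h) x
    · have h2 : y ∈ Ioc (y₁ - h) y₂ := ⟨by linarith [hy.1, hx.1], by linarith [hy.2, hx.2]⟩
      have h3 : (y, x) ∈ S := ⟨hy.2, by linarith [hy.1]⟩
      rw [indicator_of_mem hy, indicator_of_mem h2, indicator_of_mem h3]
      rfl
    · rw [indicator_of_notMem hy]; exact zero_le

lemma measure_Ioc_le_omega (F : Measure ℝ) [IsFiniteMeasure F] {h T y₀ y : ℝ} (hy₀ : 0 < y₀)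
    (hy : y₀ ≤ y) (ht : 0 < tail F y) (hT : 0 ≤ T) : F (Ioc y (y + h)) ≤
      ENNReal.ofReal (tail F y₀ / y₀) *
        (ENNReal.ofReal T + ENNReal.ofReal (max (omega F h y - T) 0)) := by
  have hy0 : 0 < y := hy₀.trans_le hy
  rw [← ENNReal.ofReal_add hT (le_max_right _ _), ← ENNReal.ofReal_mul (by
    have := tail_pos_of_le F hy ht; positivity),
    ← ENNReal.ofReal_toReal (measure_ne_top F (Ioc y (y + h)))]
  refine ENNReal.ofReal_le_ofReal ?_
  have e : (F (Ioc y (y + h))).toReal = tail F y / y * omega F h y := by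
    rw [omega, measureReal_def]; field_simp
  have hω : 0 ≤ omega F h y := by rw [omega]; positivity
  have h1 : tail F y ≤ tail F y₀ := tail_antitone F hy
  rw [e]
  have h2 : 0 ≤ tail F y₀ := ht.le.trans h1
  have h3 : omega F h y ≤ T + max (omega F h y - T) 0 := by
    linarith [le_max_left (omega F h y - T) 0]
  gcongr

/-- On a window of length at most s + h the exponential weight is at least exp(-(s + h)/(r a_n)), so
it can be inserted at the price of its inverse. The condition with η keeps the window inside the
domain of integration. -/
lemma measure_Ioc_le_overflow (F : Measure ℝ) [IsFiniteMeasure F] (A : ℝ → ℝ)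
    {h T y₀ y₁ y₂ s η r : ℝ} {n : ℕ} (hy₀ : 0 < y₀) (h₀₁ : y₀ ≤ y₁ - h)
    (h₁₂ : y₂ - y₁ ≤ s) (ht : ∀ y, 0 < tail F y) (hT : 0 ≤ T)
    (hra : 0 < r * aSeq A n) (hη : s + h ≤ η * y₂) :
    ENNReal.ofReal h * F (Ioc y₁ y₂) ≤ ENNReal.ofReal (tail F y₀ / y₀) *
      (ENNReal.ofReal (T * (s + h)) +
        ENNReal.ofReal (Real.exp ((s + h) / (r * aSeq A n))) * overflow F A h η r T n y₂) := by
  refine (measure_Ioc_le_lintegral F h y₁ y₂).trans ?_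
  calc ∫⁻ y in Ioc (y₁ - h) y₂, F (Ioc y (y + h))
      ≤ ∫⁻ y in Ioc (y₁ - h) y₂, ENNReal.ofReal (tail F y₀ / y₀) *
        (ENNReal.ofReal T + ENNReal.ofReal (max (omega F h y - T) 0)) :=
        setLIntegral_mono' measurableSet_Ioc fun y hy =>
          measure_Ioc_le_omega F hy₀ (by linarith [hy.1]) (ht y) hT
    _ = ENNReal.ofReal (tail F y₀ / y₀) * (ENNReal.ofReal T * volume (Ioc (y₁ - h) y₂) +
          ∫⁻ y in Ioc (y₁ - h) y₂, ENNReal.ofReal (max (omega F h y - T) 0)) := by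
        rw [lintegral_const_mul' _ _ ENNReal.ofReal_ne_top, lintegral_add_left measurable_const,
          setLIntegral_const]
    _ ≤ _ := by
        gcongr
        · rw [Real.volume_Ioc, ← ENNReal.ofReal_mul hT]
          refine ENNReal.ofReal_le_ofReal ?_
          gcongr
          linarith
        · rw [overflow, ← lintegral_const_mul' _ _ ENNReal.ofReal_ne_top]
          calc _ ≤ ∫⁻ y in Ioc (y₁ - h) y₂, ENNReal.ofReal (Real.exp ((s + h) / (r * aSeq A n))) *
                ENNReal.ofReal (Real.exp (-(y₂ - y) / (r * aSeq A n)) *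
                  max (omega F h y - T) 0) := by
                refine setLIntegral_mono' measurableSet_Ioc fun y hy => ?_
                rw [← ENNReal.ofReal_mul (Real.exp_pos _).le]
                refine ENNReal.ofReal_le_ofReal ?_
                rw [← mul_assoc, ← Real.exp_add, ← add_div]
                refine le_mul_of_one_le_left (le_max_right _ _) (Real.one_le_exp ?_)
                exact div_nonneg (by linarith [hy.1]) hra.le
            _ ≤ _ := by
                refine lintegral_mono_set (Ioc_subset_Ioc_left ?_)
                linarith

/-! ### Remainder bounds uniform in the truncation levels. -/

namespace StepLaw

variable {α : ℝ} {A : ℝ → ℝ} {P : Measure ℝ} [IsProbabilityMeasure P]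

lemma single_jump_le_of_macroscopic (hP : StepLaw α A P) {h : ℝ} (hh : 0 < h) {γ : ℝ}
    (hγ : 0 < γ) :
    ∃ C : ℝ, 0 < C ∧ ∀ d : ℝ, 0 < d → ∃ u₀ : ℝ, 1 ≤ u₀ ∧ ∀ (u z : ℝ) (m : ℕ), u₀ ≤ u →
      d * u ≤ aSeq A (m + 1) →
      ((m + 1 : ℕ) : ℝ≥0∞) * (P.restrict (Ioi (γ * u))).conv (convPow P m) (Ioc z (z + h)) ≤
        ENNReal.ofReal (C * ((m + 1 : ℕ) / A u) / u) := by
  obtain ⟨C₁, hC₁, H₁⟩ := hP.locBound_convPow hh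
  obtain ⟨C₂, hC₂, H₂⟩ := hP.measure_Ioc_le_of_macroscopic hγ
  refine ⟨C₁ * C₂ * (2 + h), by positivity, fun d hd => ?_⟩
  obtain ⟨u₀, hu₀, H⟩ := H₂ d hd
  refine ⟨u₀, hu₀, fun u z m hu hm => ?_⟩
  have hu0 : 0 < u := by linarith
  have hAu := hP.scale.pos hu0
  set a := aSeq A (m + 1) with ha
  have ha1 : 1 ≤ a := hP.scale.one_le_aSeq _
  have ha0 : 0 < a := by linarith
  set s := a + h with hs
  have hs0 : 0 < s := by positivity
  have hΘ : ∀ y, P.restrict (Ioi (γ * u)) (Ioc y (y + s)) ≤ ENNReal.ofReal (C₂ * (s / u) / A u) := by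
    intro y
    rw [Measure.restrict_apply measurableSet_Ioc]
    refine le_trans (measure_mono ?_) (H u s (max y (γ * u)) hu (by linarith) (le_max_right _ _))
    rintro x ⟨⟨hx1, hx2⟩, hx3⟩
    exact ⟨max_lt hx1 hx3, hx2.trans (by gcongr; exact le_max_left _ _)⟩
  have h1 := H₁ m s (by linarith) (P.restrict (Ioi (γ * u))) z _ inferInstance hΘ
  calc _ ≤ ((m + 1 : ℕ) : ℝ≥0∞) * (ENNReal.ofReal (C₁ * (1 / a + 1 / s)) *
        ENNReal.ofReal (C₂ * (s / u) / A u)) := by gcongr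
    _ = ENNReal.ofReal ((m + 1 : ℕ) * (C₁ * (1 / a + 1 / s) * (C₂ * (s / u) / A u))) := by
        rw [← ENNReal.ofReal_mul (by positivity), ← ENNReal.ofReal_natCast,
          ← ENNReal.ofReal_mul (by positivity)]
    _ ≤ _ := by
        refine ENNReal.ofReal_le_ofReal ?_
        have e : (1 / a + 1 / s) * s ≤ 2 + h := by
          have : (1 / a + 1 / s) * s = 2 + h / a := by rw [hs]; field_simp; ring
          rw [this]
          have : h / a ≤ h := div_le_self hh.le ha1
          linarith
        calc _ = C₁ * C₂ * ((1 / a + 1 / s) * s) * ((m + 1 : ℕ) / A u) / u := by ring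
          _ ≤ _ := by gcongr

/-- The point is that C is independent of c and c', whereas the constant in `convPow_truncated_le`
blows up as c - c' → 0. The dependence is moved into u₀. -/
lemma convPow_truncated_le_rate (hP : StepLaw α A P) {h : ℝ} (hh : 0 < h) {N : ℕ} (hN : 0 < N)
    (hNα : 1 < (N + 1) * α) :
    ∃ C e : ℝ, 0 < C ∧ 0 < e ∧ ∀ c c' δ : ℝ, 1 / 2 ≤ c' → c' < c → c ≤ 1 → 0 < δ → δ ≤ 1 →
      ∃ u₀ : ℝ, 1 ≤ u₀ ∧ ∀ (u z : ℝ) (m : ℕ), u₀ ≤ u → m ≤ A (δ * u) → c * u ≤ z →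
        convPow (P.restrict (Iic (c' * u / N))) m (Ioc z (z + h)) ≤
          ENNReal.ofReal (C * δ ^ e / u) := by
  have hA := hP.scale
  obtain ⟨C₁, e, hC₁, he, H₁⟩ := hA.exists_rate hNα
  have hN0 : (0 : ℝ) < N := by exact_mod_cast hN
  obtain ⟨C₂, hC₂, H₂⟩ := hP.single_jump_le_of_macroscopic hh
    (show 0 < 1 / 4 / (N : ℝ) by positivity)
  obtain ⟨C₃, u₃, hC₃, hu₃, H₃⟩ := hP.convPow_truncated_le hh hN (c := 1 / 2) (c' := 1 / 4)
    (by norm_num) (by norm_num) (by norm_num)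
  refine ⟨C₁ + C₂ * C₁ + C₃ * C₁, e, by positivity, he, ?_⟩
  intro c c' δ hc' hcc hc1 hδ hδ1
  obtain ⟨C₄, u₄, hC₄, hu₄, H₄⟩ := hP.convPow_truncated_le hh hN (by linarith) hcc hc1
  set D := max C₄ 1 with hD
  have hD1 : 1 ≤ D := le_max_right _ _
  -- With this `d`, D d^e = δ^e: for m ≤ A(du) the smaller rate cancels the bad constant D.
  set d := δ * (1 / D) ^ (1 / e) with hd
  have hd0 : 0 < d := by positivity
  have hdδ : d ≤ δ := mul_le_of_le_one_right hδ.le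
    (Real.rpow_le_one (by positivity) (by rw [div_le_one (by positivity)]; exact hD1)
      (by positivity))
  have hde : D * d ^ e = δ ^ e := by
    rw [hd, Real.mul_rpow hδ.le (by positivity), ← Real.rpow_mul (by positivity),
      one_div_mul_cancel he.ne', Real.rpow_one]
    field_simp
  obtain ⟨u₂, hu₂, H₂⟩ := H₂ d hd0
  refine ⟨max (max u₂ u₃) (max u₄ (1 / d)), hu₂.trans ((le_max_left _ _).trans (le_max_left _ _)),
    ?_⟩
  intro u z m hu hm hz
  simp only [max_le_iff] at hu
  obtain ⟨⟨hu2, hu3⟩, hu4, hud⟩ := hu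
  have hdu : 1 ≤ d * u := by rw [div_le_iff₀ hd0] at hud; linarith
  have hu0 : 0 < u := by linarith
  have hδu : 1 ≤ δ * u := hdu.trans (by gcongr)
  have hAu := hA.pos hu0
  have hX : 0 ≤ δ ^ e / u := by positivity
  by_cases hmd : m ≤ A (d * u)
  · refine (H₄ u z m hu4 hz).trans (ENNReal.ofReal_le_ofReal ?_)
    have h1 := (H₁ m d u hd0 (hdδ.trans hδ1) hdu hmd).1
    calc C₄ * ((m / A u) ^ (N + 1) / aSeq A m) ≤ D * (C₁ * d ^ e / u) := by
          have := hA.aSeq_pos m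
          gcongr
          exact le_max_left _ _
      _ = C₁ * (D * d ^ e) / u := by ring
      _ = C₁ * (δ ^ e / u) := by rw [hde]; ring
      _ ≤ (C₁ + C₂ * C₁ + C₃ * C₁) * (δ ^ e / u) := by
          gcongr
          have : 0 < C₂ * C₁ := by positivity
          have : 0 < C₃ * C₁ := by positivity
          linarith
      _ = _ := by ring
  -- Now a_m ≥ du is macroscopic. Truncation at the fixed level u/(4N) has a universal constant, and
  -- a single step above that level is controlled by regular variation.
  · push Not at hmd
    obtain ⟨n, rfl⟩ : ∃ n, m = n + 1 := by
      refine Nat.exists_eq_succ_of_ne_zero ?_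
      rintro rfl
      have := hA.pos (mul_pos hd0 hu0)
      simp only [Nat.cast_zero] at hmd
      linarith
    have hda : d * u ≤ aSeq A (n + 1) := hA.le_aSeq (mul_pos hd0 hu0) hmd.le
    set b := 1 / 4 * u / (N : ℝ) with hb
    have hsplit : P = P.restrict (Iic b) + P.restrict (Ioi b) := by
      rw [← compl_Iic, Measure.restrict_add_restrict_compl measurableSet_Iic]
    have hstep := convPow_add_measure_le (P.restrict (Iic b)) (P.restrict (Ioi b)) n
      (Ioc z (z + h))
    rw [← hsplit, Measure.add_apply, Measure.smul_apply, smul_eq_mul] at hstep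
    refine (convPow_mono Measure.restrict_le_self _ _).trans (hstep.trans ?_)
    have h1 := H₁ (n + 1) δ u hδ hδ1 hδu hm
    have h2 := H₃ u z (n + 1) hu3 (by nlinarith)
    have h3 := H₂ u z n hu2 hda
    rw [show 1 / 4 / (N : ℝ) * u = b by rw [hb]; ring] at h3
    refine (add_le_add h2 h3).trans ?_
    have ha := hA.aSeq_pos (n + 1)
    rw [← ENNReal.ofReal_add (by positivity) (by positivity)]
    refine ENNReal.ofReal_le_ofReal ?_
    calc _ ≤ C₃ * (C₁ * δ ^ e / u) + C₂ * (C₁ * δ ^ e) / u :=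
          add_le_add (mul_le_mul_of_nonneg_left h1.1 hC₃.le)
            (div_le_div_of_nonneg_right (mul_le_mul_of_nonneg_left h1.2 hC₂.le) hu0.le)
      _ = (C₂ * C₁ + C₃ * C₁) * (δ ^ e / u) := by ring
      _ ≤ (C₁ + C₂ * C₁ + C₃ * C₁) * (δ ^ e / u) := by gcongr; linarith
      _ = _ := by ring

end StepLaw

/-! ### The contribution of one large step. -/

lemma conv_Ioc_restrict_Iic (π ν : Measure ℝ) [SFinite ν] (hν : ν (Iio 0) = 0) (z h : ℝ) :
    π.conv ν (Ioc z (z + h)) ≤ (π.restrict (Iic (z + h))).conv ν (Ioc z (z + h)) := by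
  rw [conv_Ioc, conv_Ioc, ← lintegral_indicator measurableSet_Iic]
  refine lintegral_mono fun x => ?_
  by_cases hx : x ∈ Iic (z + h)
  · rw [indicator_of_mem hx]
  · rw [indicator_of_notMem hx]
    have hx' : z + h < x := by simpa using hx
    refine (measure_mono_null (fun y hy => ?_) hν).le
    exact mem_Iio.2 (by linarith [hy.2])

section LargeJump

variable {α : ℝ} {A : ℝ → ℝ} {F : Measure ℝ} [IsProbabilityMeasure F]

lemma single_jump_le_overflow (hA : NormalizedScale α A)
    (htail : tail F ~[atTop] fun x => 1 / A x) {h : ℝ} (hh : 0 < h) {N : ℕ} (hN : 0 < N) :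
    ∃ C : ℝ, 0 < C ∧ ∀ r : ℝ, 0 < r → r ≤ 1 → ∃ K : ℝ, 0 < K ∧ ∀ η : ℝ, 0 < η →
      ∃ δ₀ : ℝ, 0 < δ₀ ∧ ∀ T c₁ c' c₂ δ : ℝ, 0 ≤ T → 1 / 2 ≤ c₁ → c₁ ≤ c' → 0 < δ → δ < δ₀ →
        ∃ u₀ : ℝ, 1 ≤ u₀ ∧ ∀ (u z : ℝ) (m : ℕ), u₀ ≤ u → (m + 1 : ℕ) ≤ A (δ * u) → z ≤ c₂ * u →
          ((m + 1 : ℕ) : ℝ≥0∞) * ((posLaw F).restrict (Ioi (c' * u / N))).conv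
            (convPow (posLaw F) m) (Ioc z (z + h)) ≤
          ENNReal.ofReal K * (ENNReal.ofReal ((m + 1 : ℕ) / aSeq A (m + 1) * (tail F u / u)) *
            ⨆ t ∈ Icc (c₁ * u / N) (c₂ * u + 2 * h), overflow F A h η r T (m + 1) t) +
          ENNReal.ofReal (C * T * ((m + 1 : ℕ) * (tail F u / u))) := by
  have hP := stepLaw_posLaw hA htail
  have ht0 := tail_pos hA htail
  have hFp : F (Ioi 0) ≠ 0 := by
    rw [← ofReal_tail]; simpa using ht0 0
  have := isProbabilityMeasure_posLaw hFp
  set p := tail F 0 with hp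
  have hp0 : 0 < p := ht0 0
  have hN0 : (0 : ℝ) < N := by exact_mod_cast hN
  have hN1 : (1 : ℝ) ≤ N := by exact_mod_cast hN
  obtain ⟨C₁, hC₁, H₁⟩ := hP.locBound_convPow hh
  -- As c' ≥ 1/2, the large step exceeds 2ku, which leaves room to go back by h and stay above ku,
  -- the base point for the tail.
  set k := 1 / (4 * (N : ℝ)) with hk
  have hk0 : 0 < k := by positivity
  obtain ⟨C₂, u₂, hC₂, H₂⟩ : ∃ C u₂ : ℝ, 0 < C ∧ ∀ u, u₂ ≤ u → tail F (k * u) ≤ C * tail F u := by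
    have h1 := (tendsto_tail_div hA htail hk0).eventually (gt_mem_nhds (lt_add_one _))
    obtain ⟨u₂, hu₂⟩ := eventually_atTop.1 h1
    refine ⟨k ^ (-α) + 1, u₂, by positivity, fun u hu => ?_⟩
    have := hu₂ u hu
    rw [div_lt_iff₀ (ht0 u)] at this
    exact this.le
  obtain ⟨B, hB⟩ : ∃ B, B = C₁ * (1 / p) * (1 / h) * (C₂ / k) := ⟨_, rfl⟩
  have hB0 : 0 < B := by rw [hB]; positivity
  refine ⟨B * (3 + 2 * h), by positivity, fun r hr hr1 => ?_⟩
  refine ⟨B * (1 + 1 / r) * Real.exp (1 + 2 * h / r), by positivity, fun η hη => ?_⟩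
  -- From δ < ηk follows a ≤ ηku, and for large u also 2h ≤ ηku; together they fit the window into η
  -- y₂, since y₂ ≥ 2ku.
  refine ⟨η * k, by positivity, fun T c₁ c' c₂ δ hT hc₁ hcc hδ hδ₀ => ?_⟩
  refine ⟨max (max u₂ 1) (max (1 / δ) (max (4 * N * h) (8 * N * h / η))),
    (le_max_right _ _).trans (le_max_left _ _), ?_⟩
  intro u z m hu hm hz
  simp only [max_le_iff] at hu
  obtain ⟨⟨hu2, hu1⟩, huδ, huh, huη⟩ := hu
  have hu0 : 0 < u := by linarith
  have hδu : 1 ≤ δ * u := by rw [div_le_iff₀ hδ] at huδ; linarith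
  set a := aSeq A (m + 1) with ha
  have ha1 : 1 ≤ a := hA.one_le_aSeq _
  have ha0 : 0 < a := by linarith
  have haδ : a ≤ δ * u := hA.aSeq_le hδu hm
  -- Smoothing is used at scale ra, the decay length of the weight in the overflow; adding h ensures
  -- s ≥ h.
  set s := r * a + h with hs
  have hra : 0 < r * a := by positivity
  have hs0 : 0 < s := by positivity
  set b := c' * u / (N : ℝ) with hb
  have hbk : 2 * (k * u) ≤ b := by
    have e : 2 * (k * u) = 1 / 2 * u / N := by rw [hk]; field_simp; ring
    rw [e, hb]; gcongr; linarith
  have hkh : h ≤ k * u := by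
    rw [hk, div_mul_eq_mul_div, le_div_iff₀ (by positivity)]; linarith
  have hku0 : 0 < k * u := by positivity
  set Sup := ⨆ t ∈ Icc (c₁ * u / N) (c₂ * u + 2 * h), overflow F A h η r T (m + 1) t with hSup
  set θ := tail F u / u with hθ
  have htu := ht0 u
  have hθ0 : 0 < θ := by positivity
  set Θ := ENNReal.ofReal (1 / p * (1 / h) * (C₂ / k * θ)) * (ENNReal.ofReal (T * (s + h)) +
    ENNReal.ofReal (Real.exp (1 + 2 * h / r)) * Sup) with hΘdef
  have hpinv : (F (Ioi 0))⁻¹ = ENNReal.ofReal (1 / p) := by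
    rw [one_div, ENNReal.ofReal_inv_of_pos hp0, hp, ofReal_tail]
  have hkey : ∀ y₁ y₂, b ≤ y₁ → y₁ < y₂ → y₂ ≤ z + h → y₂ - y₁ ≤ s →
      posLaw F (Ioc y₁ y₂) ≤ Θ := by
    intro y₁ y₂ h1 h2 h3 h4
    have hy₂ : b ≤ y₂ := by linarith
    have hη2 : s + h ≤ η * y₂ := by
      have e1 : s + h ≤ a + 2 * h := by rw [hs]; nlinarith
      have e2 : a ≤ η * (k * u) := haδ.trans (by
        rw [← mul_assoc]; gcongr)
      have e3 : 2 * h ≤ η * (k * u) := by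
        rw [div_le_iff₀ hη] at huη
        rw [hk, div_mul_eq_mul_div, mul_div_assoc', le_div_iff₀ (by positivity)]
        linarith
      have e4 : η * (2 * (k * u)) ≤ η * y₂ := by gcongr; linarith
      linarith
    have h5 := measure_Ioc_le_overflow F A (T := T) (n := m + 1) (η := η) (r := r) hku0
      (by linarith : k * u ≤ y₁ - h) h4 ht0 hT hra hη2
    have hmem : y₂ ∈ Icc (c₁ * u / N) (c₂ * u + 2 * h) := by
      refine ⟨le_trans ?_ hy₂, by linarith⟩
      rw [hb]; gcongr
    have h6 : overflow F A h η r T (m + 1) y₂ ≤ Sup :=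
      le_iSup₂ (f := fun t (_ : t ∈ Icc (c₁ * u / N) (c₂ * u + 2 * h)) =>
        overflow F A h η r T (m + 1) t) y₂ hmem
    have h7 : Real.exp ((s + h) / (r * aSeq A (m + 1))) ≤ Real.exp (1 + 2 * h / r) := by
      refine Real.exp_le_exp.2 ?_
      rw [← ha]
      have : (s + h) / (r * a) = 1 + 2 * h / (r * a) := by rw [hs]; field_simp; ring
      rw [this]
      gcongr
      exact le_mul_of_one_le_right hr.le ha1
    have h8 : tail F (k * u) / (k * u) ≤ C₂ / k * θ := by
      calc tail F (k * u) / (k * u) ≤ C₂ * tail F u / (k * u) := by gcongr; exact H₂ u hu2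
        _ = _ := by rw [hθ]; field_simp
    have h9 : F (Ioc y₁ y₂) = ENNReal.ofReal (1 / h) * (ENNReal.ofReal h * F (Ioc y₁ y₂)) := by
      rw [← mul_assoc, ← ENNReal.ofReal_mul (by positivity), one_div_mul_cancel hh.ne',
        ENNReal.ofReal_one, one_mul]
    refine (posLaw_apply_le F _).trans ?_
    rw [hpinv, h9]
    calc _ ≤ ENNReal.ofReal (1 / p) * (ENNReal.ofReal (1 / h) *
          (ENNReal.ofReal (C₂ / k * θ) * (ENNReal.ofReal (T * (s + h)) +
            ENNReal.ofReal (Real.exp (1 + 2 * h / r)) * Sup))) := by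
          refine mul_le_mul_right (mul_le_mul_right (h5.trans ?_) _) _
          gcongr
      _ = Θ := by
          rw [hΘdef, ENNReal.ofReal_mul (p := 1 / p * (1 / h)) (by positivity),
            ENNReal.ofReal_mul (p := 1 / p) (by positivity)]
          ring
  have hΘ : ∀ y, (((posLaw F).restrict (Ioi b)).restrict (Iic (z + h))) (Ioc y (y + s)) ≤ Θ := by
    intro y
    rw [Measure.restrict_apply measurableSet_Ioc,
      Measure.restrict_apply (measurableSet_Ioc.inter measurableSet_Iic)]
    rcases lt_or_ge (max y b) (min (y + s) (z + h)) with hlt | hge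
    · refine le_trans (measure_mono ?_) (hkey (max y b) (min (y + s) (z + h)) (le_max_right _ _)
        hlt (min_le_right _ _) ?_)
      · rintro x ⟨⟨⟨hx1, hx2⟩, hx3⟩, hx4⟩
        exact ⟨max_lt hx1 hx4, le_min hx2 hx3⟩
      · have h1 := le_max_left y b
        have h2 := min_le_left (y + s) (z + h)
        linarith
    · refine le_of_eq_of_le (measure_mono_null (t := ∅) ?_ measure_empty) zero_le
      rintro x ⟨⟨⟨hx1, hx2⟩, hx3⟩, hx4⟩
      exact absurd (lt_of_lt_of_le (max_lt hx1 hx4) (le_min hx2 hx3)) (not_lt.2 hge)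
  have hsupp := convPow_Iio_zero (posLaw F) hP.Iio_zero m
  have hconv := (conv_Ioc_restrict_Iic ((posLaw F).restrict (Ioi b)) _ hsupp z h).trans
    (H₁ m s (by linarith) _ z Θ inferInstance hΘ)
  set n : ℝ := ((m + 1 : ℕ) : ℝ) with hn
  have hn0 : 0 < n := by rw [hn]; positivity
  obtain ⟨q, hq⟩ : ∃ q, q = C₁ * (1 / a + 1 / s) := ⟨_, rfl⟩
  have hq0 : 0 < q := by rw [hq]; positivity
  rw [← hq] at hconv
  have hmul : n * q * (1 / p * (1 / h) * (C₂ / k * θ)) = n * θ * B * (1 / a + 1 / s) := by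
    rw [hq, hB]; ring
  calc _ ≤ ((m + 1 : ℕ) : ℝ≥0∞) * (ENNReal.ofReal q * Θ) := by gcongr
    _ = ENNReal.ofReal (n * θ * B * (1 / a + 1 / s)) * (ENNReal.ofReal (T * (s + h)) +
        ENNReal.ofReal (Real.exp (1 + 2 * h / r)) * Sup) := by
        rw [← ENNReal.ofReal_natCast, ← hn, hΘdef, ← mul_assoc, ← mul_assoc,
          ← ENNReal.ofReal_mul hn0.le, ← ENNReal.ofReal_mul (by positivity), hmul]
    _ = ENNReal.ofReal (n * θ * B * (1 / a + 1 / s) * (T * (s + h))) +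
        ENNReal.ofReal (n * θ * B * (1 / a + 1 / s) * Real.exp (1 + 2 * h / r)) * Sup := by
        rw [mul_add, ← mul_assoc, ← ENNReal.ofReal_mul (by positivity),
          ← ENNReal.ofReal_mul (by positivity)]
    _ ≤ _ := by
        rw [add_comm, ← mul_assoc (ENNReal.ofReal _) (ENNReal.ofReal _) Sup,
          ← ENNReal.ofReal_mul (by positivity)]
        refine add_le_add (mul_le_mul_left (ENNReal.ofReal_le_ofReal ?_) _)
          (ENNReal.ofReal_le_ofReal ?_)
        · have e1 : 1 / a + 1 / s ≤ (1 + 1 / r) * (1 / a) := by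
            have : 1 / s ≤ 1 / (r * a) := by gcongr; rw [hs]; linarith
            have e : 1 / (r * a) = 1 / r * (1 / a) := by field_simp
            rw [e] at this
            linarith
          calc _ ≤ n * θ * B * ((1 + 1 / r) * (1 / a)) * Real.exp (1 + 2 * h / r) := by gcongr
            _ = _ := by ring
        -- In the term with T the length of the window cancels 1/s, and r ≤ 1 bounds the rest, so
        -- this constant does not depend on r.
        · have e1 : (1 / a + 1 / s) * (s + h) ≤ 3 + 2 * h := by
            have e2 : (1 / a + 1 / s) * (s + h) = r + 2 * (h / a) + 1 + h / s := by
              rw [hs]; field_simp; ring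
            have e3 : h / a ≤ h := div_le_self hh.le ha1
            have e4 : h / s ≤ 1 := by rw [div_le_one hs0]; linarith
            rw [e2]; linarith
          calc _ = B * ((1 / a + 1 / s) * (s + h)) * T * (n * θ) := by ring
            _ ≤ _ := by gcongr

/-- The local large deviation bound for sums of positive steps. -/
lemma local_large_deviation (hA : NormalizedScale α A)
    (htail : tail F ~[atTop] fun x => 1 / A x) {h : ℝ} (hh : 0 < h) {N : ℕ} (hN : 0 < N)
    (hNα : 1 < (N + 1) * α) :
    ∃ C e : ℝ, 0 < C ∧ 0 < e ∧ ∀ r : ℝ, 0 < r → r ≤ 1 → ∃ K : ℝ, 0 < K ∧ ∀ η : ℝ, 0 < η →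
      ∃ δ₀ : ℝ, 0 < δ₀ ∧ δ₀ ≤ 1 ∧ ∀ T c₀ c₁ c₂ δ : ℝ, 0 ≤ T → 1 / 2 ≤ c₁ → c₁ < c₀ → c₀ ≤ 1 →
        0 < δ → δ < δ₀ →
        ∃ u₀ : ℝ, 1 ≤ u₀ ∧ ∀ (u z : ℝ) (m : ℕ), u₀ ≤ u → m ≤ A (δ * u) → c₀ * u ≤ z → z ≤ c₂ * u →
          convPow (posLaw F) m (Ioc z (z + h)) ≤
          ENNReal.ofReal K * (ENNReal.ofReal (m / aSeq A m * (tail F u / u)) *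
            ⨆ t ∈ Icc (c₁ * u / N) (c₂ * u + 2 * h), overflow F A h η r T m t) +
          ENNReal.ofReal (C * T * (m * (tail F u / u))) + ENNReal.ofReal (C * δ ^ e / u) := by
  have hP := stepLaw_posLaw hA htail
  have hFp : F (Ioi 0) ≠ 0 := by
    rw [← ofReal_tail]; simpa using tail_pos hA htail 0
  have := isProbabilityMeasure_posLaw hFp
  obtain ⟨C₁, hC₁, H₁⟩ := single_jump_le_overflow hA htail hh hN
  obtain ⟨C₂, e, hC₂, he, H₂⟩ := hP.convPow_truncated_le_rate hh hN hNα
  refine ⟨max C₁ C₂, e, by positivity, he, fun r hr hr1 => ?_⟩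
  obtain ⟨K, hK, H₁⟩ := H₁ r hr hr1
  refine ⟨K, hK, fun η hη => ?_⟩
  obtain ⟨δ₀, hδ₀, H₁⟩ := H₁ η hη
  refine ⟨min δ₀ 1, by positivity, min_le_right _ _, ?_⟩
  intro T c₀ c₁ c₂ δ hT hc₁ hcc hc₀ hδ hδδ
  have hδ1 : δ ≤ 1 := (hδδ.trans_le (min_le_right _ _)).le
  -- The midpoint lies strictly below c₀, so the truncated sum falls short of its target, and above
  -- c₁, so the large step lies in the range of the supremum.
  set c' := (c₁ + c₀) / 2 with hc'
  obtain ⟨u₁, hu₁, H₁⟩ := H₁ T c₁ c' c₂ δ hT hc₁ (by linarith) hδ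
    (hδδ.trans_le (min_le_left _ _))
  obtain ⟨u₂, hu₂, H₂⟩ := H₂ c₀ c' δ (by linarith) (by linarith) hc₀ hδ hδ1
  refine ⟨max u₁ u₂, hu₁.trans (le_max_left _ _), ?_⟩
  intro u z m hu hm hz1 hz2
  have hu0 : 0 < u := by linarith [le_max_left u₁ u₂]
  have htu := tail_pos hA htail u
  have hrest := H₂ u z m ((le_max_right _ _).trans hu) hm hz1
  have hrest' : ENNReal.ofReal (C₂ * δ ^ e / u) ≤ ENNReal.ofReal (max C₁ C₂ * δ ^ e / u) := by
    refine ENNReal.ofReal_le_ofReal ?_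
    gcongr
    exact le_max_right _ _
  rcases m with _ | m
  · have h0 : convPow (posLaw F) 0 = convPow ((posLaw F).restrict (Iic (c' * u / N))) 0 := rfl
    rw [h0]
    exact (hrest.trans hrest').trans le_add_self
  · set b := c' * u / (N : ℝ) with hb
    have hsplit : posLaw F = (posLaw F).restrict (Iic b) + (posLaw F).restrict (Ioi b) := by
      rw [← compl_Iic, Measure.restrict_add_restrict_compl measurableSet_Iic]
    have hstep := convPow_add_measure_le ((posLaw F).restrict (Iic b))
      ((posLaw F).restrict (Ioi b)) m (Ioc z (z + h))
    rw [← hsplit, Measure.add_apply, Measure.smul_apply, smul_eq_mul] at hstep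
    refine hstep.trans ?_
    rw [add_comm]
    refine add_le_add ((H₁ u z m ((le_max_left _ _).trans hu) hm hz2).trans ?_)
      (hrest.trans hrest')
    gcongr
    exact le_max_left _ _

end LargeJump

/-! ### Conditioning on signs and negative parts. -/

section SignDecomposition

lemma numPos_eq_sum {n : ℕ} (s : Fin n → ℝ) : numPos s = ∑ i, if 0 < s i then 1 else 0 := by
  rw [numPos, Nat.card_eq_fintype_card, Fintype.card_subtype, Finset.card_filter]

lemma numPos_le {n : ℕ} (s : Fin n → ℝ) : numPos s ≤ n := by
  rw [numPos, Nat.card_eq_fintype_card]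
  exact (Fintype.card_subtype_le _).trans (by simp)

lemma negSum_nonneg {n : ℕ} (s : Fin n → ℝ) : 0 ≤ negSum s :=
  Finset.sum_nonneg fun _ _ => le_max_right _ _

lemma measurable_numPos {n : ℕ} : Measurable fun s : Fin n → ℝ => numPos s := by
  simp_rw [numPos_eq_sum]
  refine Finset.measurable_sum _ fun i _ => ?_
  exact Measurable.ite (measurableSet_lt measurable_const (measurable_pi_apply i))
    measurable_const measurable_const

lemma measurable_negSum {n : ℕ} : Measurable fun s : Fin n → ℝ => negSum s := by
  unfold negSum; fun_prop

lemma numPos_succ {n : ℕ} (s : Fin (n + 1) → ℝ) :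
    numPos s = numPos (fun j : Fin n => s j.succ) + if 0 < s 0 then 1 else 0 := by
  rw [numPos_eq_sum, numPos_eq_sum, Fin.sum_univ_succ, add_comm]

lemma negSum_succ {n : ℕ} (s : Fin (n + 1) → ℝ) :
    negSum s = negSum (fun j : Fin n => s j.succ) + max (-(s 0)) 0 := by
  rw [negSum, negSum, Fin.sum_univ_succ, add_comm]

lemma smul_posLaw {F : Measure ℝ} [IsFiniteMeasure F] (h : F (Ioi 0) ≠ 0) :
    F (Ioi 0) • posLaw F = F.restrict (Ioi 0) := by
  rw [posLaw, smul_smul, ENNReal.mul_inv_cancel h (measure_ne_top _ _), one_smul]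

lemma measurable_lintegral_convPow (P : Measure ℝ) [IsFiniteMeasure P] {f : ℝ → ℝ≥0∞}
    (hf : Measurable f) :
    Measurable fun q : ℕ × ℝ => ∫⁻ v, f (v - q.2) ∂(convPow P q.1) := by
  refine measurable_from_prod_countable_right fun m => ?_
  have : Measurable (Function.uncurry fun c v : ℝ => f (v - c)) :=
    hf.comp (measurable_snd.sub measurable_fst)
  exact this.lintegral_prod_right (ν := convPow P m)

/-- One step of the induction: on a > 0 the step becomes one more factor `posLaw F`, whose mass F(0,
∞) is recovered by integrating over a; on a ≤ 0 it only shifts the target. -/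
lemma lintegral_step (F : Measure ℝ) [IsProbabilityMeasure F] (hF : F (Ioi 0) ≠ 0)
    {f : ℝ → ℝ≥0∞} (hf : Measurable f) (N : ℕ) (c : ℝ) :
    ∫⁻ a, ∫⁻ v, f (v - (c + max (-a) 0)) ∂(convPow (posLaw F) (N + if 0 < a then 1 else 0)) ∂F =
      ∫⁻ a, ∫⁻ v, f (v - (c - a)) ∂(convPow (posLaw F) N) ∂F := by
  have := isProbabilityMeasure_posLaw hF
  have hfc : Measurable fun v => f (v - c) := hf.comp (measurable_id.sub_const c)
  rw [← lintegral_add_compl _ (measurableSet_Ioi (a := (0 : ℝ))), ← lintegral_add_compl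
    (fun a => ∫⁻ v, f (v - (c - a)) ∂(convPow (posLaw F) N)) (measurableSet_Ioi (a := (0 : ℝ)))]
  congr 1
  · calc _ = ∫⁻ a in Ioi 0, ∫⁻ v, f (v - c) ∂(convPow (posLaw F) (N + 1)) ∂F := by
          refine setLIntegral_congr_fun measurableSet_Ioi fun a ha => ?_
          have ha' : 0 < a := ha
          simp only [ha', if_true]
          rw [max_eq_right (by linarith), add_zero]
      _ = F (Ioi 0) * ∫⁻ a, ∫⁻ v, f (v - (c - a)) ∂(convPow (posLaw F) N) ∂(posLaw F) := by
          rw [setLIntegral_const, mul_comm, convPow_succ', Measure.lintegral_conv hfc]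
          congr 1
          refine lintegral_congr fun a => lintegral_congr fun v => ?_
          congr 1; ring
      _ = _ := by
          conv_rhs => rw [← smul_posLaw hF]
          rw [lintegral_smul_measure, smul_eq_mul]
  · refine setLIntegral_congr_fun measurableSet_Ioi.compl fun a ha => ?_
    have ha' : ¬ 0 < a := ha
    simp only [ha', if_false, add_zero]
    rw [max_eq_left (by linarith), sub_eq_add_neg]

/-- Given the signs and the negative parts of the steps, the positive steps are independent with
law `posLaw F`. -/
lemma lintegral_convPow_eq (F : Measure ℝ) [IsProbabilityMeasure F] (hF : F (Ioi 0) ≠ 0) (n : ℕ)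
    {f : ℝ → ℝ≥0∞} (hf : Measurable f) :
    ∫⁻ x, f x ∂(convPow F n) = ∫⁻ s : Fin n → ℝ,
      (∫⁻ v, f (v - negSum s) ∂(convPow (posLaw F) (numPos s))) ∂(Measure.pi fun _ => F) := by
  have := isProbabilityMeasure_posLaw hF
  induction n generalizing f with
  | zero =>
    have h0 : ∀ s : Fin 0 → ℝ, numPos s = 0 ∧ negSum s = 0 := fun s => by
      simp [numPos_eq_sum, negSum]
    simp_rw [h0, convPow]
    simp [lintegral_dirac' _ hf]
  | succ n ih =>
    have hΦ := measurable_lintegral_convPow (posLaw F) hf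
    set Φ : ℕ × ℝ → ℝ≥0∞ := fun q => ∫⁻ v, f (v - q.2) ∂(convPow (posLaw F) q.1)
    set g : ℝ × (Fin n → ℝ) → ℝ≥0∞ := fun q =>
      Φ (numPos q.2 + (if 0 < q.1 then 1 else 0), negSum q.2 + max (-q.1) 0) with hg
    have hgm : Measurable g := by
      refine hΦ.comp (Measurable.prodMk ?_ ?_)
      · exact (measurable_numPos.comp measurable_snd).add (Measurable.ite
          (measurableSet_lt measurable_const measurable_fst) measurable_const measurable_const)
      · exact (measurable_negSum.comp measurable_snd).add
          (measurable_fst.neg.max measurable_const)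
    have hpres := measurePreserving_piFinSuccAbove (fun _ : Fin (n + 1) => F) 0
    have hsw : Measurable fun q : ℝ × (Fin n → ℝ) => Φ (numPos q.2, negSum q.2 - q.1) :=
      hΦ.comp ((measurable_numPos.comp measurable_snd).prodMk
        ((measurable_negSum.comp measurable_snd).sub measurable_fst))
    calc ∫⁻ x, f x ∂(convPow F (n + 1)) = ∫⁻ a, ∫⁻ x, f (a + x) ∂(convPow F n) ∂F := by
          rw [convPow_succ', Measure.lintegral_conv hf]
      _ = ∫⁻ a, ∫⁻ s : Fin n → ℝ, Φ (numPos s, negSum s - a) ∂(Measure.pi fun _ => F) ∂F := by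
          refine lintegral_congr fun a => ?_
          refine (ih (f := fun x => f (a + x)) (hf.comp (measurable_const_add a))).trans ?_
          refine lintegral_congr fun s => lintegral_congr fun v => ?_
          congr 1; ring
      _ = ∫⁻ s : Fin n → ℝ, ∫⁻ a, Φ (numPos s, negSum s - a) ∂F ∂(Measure.pi fun _ => F) :=
          lintegral_lintegral_swap hsw.aemeasurable
      _ = ∫⁻ s : Fin n → ℝ, ∫⁻ a, g (a, s) ∂F ∂(Measure.pi fun _ => F) :=
          lintegral_congr fun s => (lintegral_step F hF hf (numPos s) (negSum s)).symm
      _ = ∫⁻ q, g q ∂(F.prod (Measure.pi fun _ : Fin n => F)) :=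
          (lintegral_prod_symm' _ hgm).symm
      _ = ∫⁻ s : Fin (n + 1) → ℝ, g (s 0, fun j => s j.succ) ∂(Measure.pi fun _ => F) :=
          (hpres.lintegral_comp hgm).symm
      _ = _ := by
          refine lintegral_congr fun s => ?_
          simp only [hg]
          rw [← numPos_succ s, ← negSum_succ s]

end SignDecomposition

lemma convPow_Ioc_eq_lintegral (F : Measure ℝ) [IsProbabilityMeasure F] (hF : F (Ioi 0) ≠ 0)
    (n : ℕ) (y h : ℝ) :
    convPow F n (Ioc y (y + h)) = ∫⁻ s : Fin n → ℝ,
      convPow (posLaw F) (numPos s) (Ioc (y + negSum s) (y + negSum s + h))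
        ∂(Measure.pi fun _ => F) := by
  rw [← lintegral_indicator_one measurableSet_Ioc, lintegral_convPow_eq F hF n
    (measurable_one.indicator measurableSet_Ioc)]
  refine lintegral_congr fun s => ?_
  rw [← lintegral_indicator_one measurableSet_Ioc]
  refine lintegral_congr fun v => ?_
  have : v - negSum s ∈ Ioc y (y + h) ↔
      v ∈ Ioc (y + negSum s) (y + negSum s + h) := by
    simp only [mem_Ioc]
    constructor <;> rintro ⟨h1, h2⟩ <;> constructor <;> linarith
  by_cases hv : v ∈ Ioc (y + negSum s) (y + negSum s + h)
  · rw [indicator_of_mem hv, indicator_of_mem (this.2 hv)]; rfl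
  · rw [indicator_of_notMem hv, indicator_of_notMem (fun h => hv (this.1 h))]

/-! ### Summation over n and passage to the limit. -/

lemma smallN_le_bigR_add {α : ℝ} {A : ℝ → ℝ} {F : Measure ℝ} [IsProbabilityMeasure F]
    (hA : NormalizedScale α A) (htail : tail F ~[atTop] fun x => 1 / A x) {h : ℝ} (hh : 0 < h) :
    ∃ C e : ℝ, 0 < C ∧ 0 < e ∧ ∀ r : ℝ, 0 < r → r ≤ 1 → ∃ K : ℝ, 0 < K ∧ ∀ η : ℝ, 0 < η →
      ∃ δ₀ : ℝ, 0 < δ₀ ∧ ∀ (L : ℝ → ℝ) (T c₀ c₁ c₂ δ : ℝ), 0 ≤ T → 1 / 2 ≤ c₁ → c₁ < c₀ →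
        c₀ ≤ 1 → 1 ≤ c₂ → 0 < δ → δ < δ₀ → ∀ᶠ x in atTop,
          smallN F A h L c₀ c₂ δ x ≤ ENNReal.ofReal K * bigR F A α h L T η r c₁ c₂ δ x +
            ENNReal.ofReal (C * T * ((A (δ * x) + 1) ^ 2 * tail F x / A x) +
              C * δ ^ e * ((A (δ * x) + 1) / A x)) := by
  have hα0 := hA.exponent_pos
  have hα1 := hA.exponent_lt_one
  set N := ⌊1 / α⌋₊ with hN
  have hN0 : 0 < N := by
    rw [hN, Nat.floor_pos, le_div_iff₀ hα0]; linarith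
  have hNα : 1 < ((N : ℝ) + 1) * α := by
    have := Nat.lt_floor_add_one (1 / α)
    rwa [div_lt_iff₀ hα0] at this
  have hFp : F (Ioi 0) ≠ 0 := by
    rw [← ofReal_tail]; simpa using tail_pos hA htail 0
  obtain ⟨C, e, hC, he, H⟩ := local_large_deviation hA htail hh hN0 hNα
  refine ⟨C, e, hC, he, fun r hr hr1 => ?_⟩
  obtain ⟨K, hK, H⟩ := H r hr hr1
  refine ⟨K, hK, fun η hη => ?_⟩
  obtain ⟨δ₀, hδ₀, hδ₀1, H⟩ := H η hη
  refine ⟨δ₀, hδ₀, ?_⟩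
  intro L T c₀ c₁ c₂ δ hT hc₁ hcc hc₀ hc₂ hδ hδδ
  obtain ⟨u₀, hu₀, H⟩ := H T c₀ c₁ c₂ δ hT hc₁ hcc hc₀ hδ hδδ
  filter_upwards [eventually_ge_atTop u₀] with x hx
  have hx0 : 0 < x := by linarith
  have hAx := hA.pos hx0
  have hδx : 0 < δ * x := mul_pos hδ hx0
  have hAδ := hA.pos hδx
  have htx := tail_pos hA htail x
  set M := ⌈A (δ * x)⌉₊ with hM
  have hM1 : (M : ℝ) ≤ A (δ * x) + 1 := (Nat.ceil_lt_add_one hAδ.le).le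
  set B : ℝ := C * T * ((A (δ * x) + 1) * (tail F x / x)) + C * δ ^ e / x with hB
  have hB0 : 0 ≤ B := by positivity
  set J : ∀ n : ℕ, (Fin n → ℝ) → ℝ≥0∞ := fun n s =>
    ENNReal.ofReal ((numPos s : ℝ) / aSeq A (numPos s) *
        (tail F (x + negSum s) / (x + negSum s))) *
      ⨆ t ∈ Icc (c₁ * (x + negSum s) / (N : ℝ)) (c₂ * (x + negSum s) + 2 * h),
        overflow F A h η r T (numPos s) t with hJ
  have hterm : ∀ n ∈ Finset.Ico ⌈L x⌉₊ M,
      ⨆ y ∈ Icc (c₀ * x) (c₂ * x), convPow F n (Ioc y (y + h)) ≤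
        ENNReal.ofReal K * ∫⁻ s : Fin n → ℝ, J n s ∂(Measure.pi fun _ : Fin n => F) +
          ENNReal.ofReal B := by
    intro n hn
    have hnA : (n : ℝ) < A (δ * x) := Nat.lt_ceil.1 (Finset.mem_Ico.1 hn).2
    refine iSup₂_le fun y hy => ?_
    rw [convPow_Ioc_eq_lintegral F hFp]
    calc _ ≤ ∫⁻ s : Fin n → ℝ, (ENNReal.ofReal K * J n s + ENNReal.ofReal B)
          ∂(Measure.pi fun _ : Fin n => F) := by
          refine lintegral_mono fun s => ?_
          have hS := negSum_nonneg s
          set u := x + negSum s with hu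
          have hxu : x ≤ u := by linarith
          have hu0 : 0 < u := by linarith
          have hm : (numPos s : ℝ) ≤ n := by exact_mod_cast numPos_le s
          have hAmono : A (δ * x) ≤ A (δ * u) := hA.le_of_le hδx (by gcongr)
          have h1 := H u (y + negSum s) (numPos s) (hx.trans hxu) (by linarith)
            (by rw [hu]; nlinarith [hy.1]) (by rw [hu]; nlinarith [hy.2])
          refine h1.trans ?_
          rw [add_assoc]
          refine add_le_add le_rfl ?_
          have htu := tail_pos hA htail u
          rw [← ENNReal.ofReal_add (by positivity) (by positivity)]
          refine ENNReal.ofReal_le_ofReal ?_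
          rw [hB]
          have h2 := tail_antitone F hxu
          gcongr
          linarith
      _ = _ := by
          rw [lintegral_add_right _ measurable_const,
            lintegral_const_mul' _ _ ENNReal.ofReal_ne_top, lintegral_const, measure_univ, mul_one]
  calc smallN F A h L c₀ c₂ δ x
      ≤ ENNReal.ofReal (x / A x) * ∑ n ∈ Finset.Ico ⌈L x⌉₊ M,
        (ENNReal.ofReal K * ∫⁻ s : Fin n → ℝ, J n s ∂(Measure.pi fun _ : Fin n => F) +
          ENNReal.ofReal B) := by
        rw [smallN]
        gcongr with n hn
        exact hterm n hn
    _ = ENNReal.ofReal K * bigR F A α h L T η r c₁ c₂ δ x + ENNReal.ofReal (x / A x) *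
        ((Finset.Ico ⌈L x⌉₊ M).card * ENNReal.ofReal B) := by
        rw [Finset.sum_add_distrib, mul_add, ← Finset.mul_sum, Finset.sum_const, nsmul_eq_mul,
          bigR, mul_left_comm]
    _ ≤ ENNReal.ofReal K * bigR F A α h L T η r c₁ c₂ δ x + ENNReal.ofReal (x / A x) *
        (ENNReal.ofReal (A (δ * x) + 1) * ENNReal.ofReal B) := by
        gcongr
        rw [Nat.card_Ico, ← ENNReal.ofReal_natCast]
        refine ENNReal.ofReal_le_ofReal (le_trans ?_ hM1)
        exact_mod_cast Nat.sub_le _ _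
    _ = _ := by
        rw [← ENNReal.ofReal_mul (by positivity), ← ENNReal.ofReal_mul (by positivity)]
        congr 2
        rw [hB]; field_simp

/-- A(δx)/A(x) → δ^α, A → ∞ makes the added 1 negligible, and F̄(x)A(x) → 1 turns the quadratic term
into δ^(2α). -/
lemma tendsto_remainder {α : ℝ} {A : ℝ → ℝ} {F : Measure ℝ}
    (hA : NormalizedScale α A) (htail : tail F ~[atTop] fun x => 1 / A x) {δ : ℝ} (hδ : 0 < δ)
    (a b : ℝ) :
    Tendsto (fun x => a * ((A (δ * x) + 1) ^ 2 * tail F x / A x) + b * ((A (δ * x) + 1) / A x))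
      atTop (𝓝 (a * δ ^ (2 * α) + b * δ ^ α)) := by
  have h1 : Tendsto (fun x => (A (δ * x) + 1) / A x) atTop (𝓝 (δ ^ α)) := by
    have h2 := (hA.regular.tendsto δ hδ).add (tendsto_inv_atTop_zero.comp hA.tendsto_atTop)
    rw [add_zero] at h2
    refine h2.congr fun x => ?_
    simp only [Function.comp]
    rw [add_div, one_div]
  refine Tendsto.add ?_ (h1.const_mul b)
  have h3 := ((h1.pow 2).mul (tendsto_tail_mul hA htail)).const_mul a
  rw [mul_one, ← Real.rpow_natCast, ← Real.rpow_mul hδ.le] at h3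
  rw [show 2 * α = α * ((2 : ℕ) : ℝ) by push_cast; ring]
  refine h3.congr' ?_
  filter_upwards [eventually_gt_atTop 0] with x hx
  have := hA.pos hx
  field_simp

lemma limsup_add_le_of_tendsto {ι : Type*} {l : Filter ι} {u v : ι → ℝ≥0∞} {b : ℝ≥0∞}
    (hv : Tendsto v l (𝓝 b)) (hb : b ≠ ∞) :
    limsup (fun i => u i + v i) l ≤ limsup u l + b := by
  refine ENNReal.le_of_forall_pos_le_add fun ε hε hfin => ?_
  have hu : limsup u l ≠ ∞ := ne_top_of_le_ne_top hfin.ne le_self_add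
  have hε2 : ((ε / 2 : NNReal) : ℝ≥0∞) ≠ 0 := ENNReal.coe_ne_zero.2 (half_pos hε).ne'
  have hev1 := eventually_lt_of_limsup_lt (ENNReal.lt_add_right hu hε2)
  have hev2 := hv.eventually (gt_mem_nhds (ENNReal.lt_add_right hb hε2))
  refine limsup_le_of_le (by isBoundedDefault) ?_
  filter_upwards [hev1, hev2] with i h1 h2
  refine (add_le_add h1.le h2.le).trans (le_of_eq ?_)
  rw [add_add_add_comm, ← ENNReal.coe_add, add_halves]

end SmallN

end

theorem mainTheorem3 (α : ℝ) (hα0 : 0 < α) (hα1 : α < 1)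
    (F : Measure ℝ) [IsProbabilityMeasure F]
    (A : ℝ → ℝ) (hA : SmallN.IsRegularlyVarying α A)
    (hAsmooth : ContDiffOn ℝ 1 A (Ioi 0)) (hAmono : StrictMonoOn A (Ioi 0)) (hAone : A 1 = 1)
    (htail : SmallN.tail F ~[atTop] fun x => 1 / A x)
    (h : ℝ) (hh : 0 < h) :
    ∃ C : ℝ, 0 < C ∧ ∃ ρ : ℝ → ℝ, ρ =o[𝓝[>] 0] (fun δ => δ ^ α) ∧
      ∀ r : ℝ, 0 < r → r ≤ 1 → ∃ K : ℝ, 0 < K ∧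
        ∀ η : ℝ, 0 < η → η < 1 → ∃ δ₀ : ℝ, 0 < δ₀ ∧
          ∀ (L : ℝ → ℝ) (T c₀ c₁ c₂ : ℝ), (∀ x, 0 < x → 0 < L x) → 0 ≤ T →
            1 / 2 ≤ c₁ → c₁ < c₀ → c₀ ≤ 1 → 1 ≤ c₂ →
            ∀ δ : ℝ, 0 < δ → δ < δ₀ →
              limsup (fun x => SmallN.smallN F A h L c₀ c₂ δ x) atTop ≤
                ENNReal.ofReal K *
                    limsup (fun x => SmallN.bigR F A α h L T η r c₁ c₂ δ x) atTop +
                  ENNReal.ofReal (C * δ ^ (2 * α) * T) + ENNReal.ofReal (ρ δ) := by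
  have hN : SmallN.NormalizedScale α A := ⟨hα0, hα1, hA, hAsmooth.continuousOn, hAmono, hAone⟩
  obtain ⟨C, e, hC, he, H⟩ := SmallN.smallN_le_bigR_add hN htail hh
  -- ρ(δ) = Cδ^e δ^α: the gain δ^e comes from sums without a large step, and δ^α from the number of
  -- values of n.
  refine ⟨C, hC, fun δ => C * δ ^ e * δ ^ α, ?_, fun r hr hr1 => ?_⟩
  · have h1 : Tendsto (fun δ : ℝ => C * δ ^ e) (𝓝[>] 0) (𝓝 0) := by
      have h2 : Tendsto (fun δ : ℝ => C * δ ^ e) (𝓝 0) (𝓝 (C * 0 ^ e)) :=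
        ((Real.continuousAt_rpow_const 0 e (Or.inr he.le)).tendsto).const_mul C
      rw [Real.zero_rpow he.ne', mul_zero] at h2
      exact h2.mono_left nhdsWithin_le_nhds
    have h3 := ((isLittleO_one_iff ℝ).2 h1).mul_isBigO
      (isBigO_refl (fun δ : ℝ => δ ^ α) (𝓝[>] 0))
    simpa only [one_mul] using h3
  obtain ⟨K, hK, H⟩ := H r hr hr1
  refine ⟨K, hK, fun η hη _ => ?_⟩
  obtain ⟨δ₀, hδ₀, H⟩ := H η hη
  refine ⟨δ₀, hδ₀, ?_⟩
  intro L T c₀ c₁ c₂ _ hT hc₁ hcc hc₀ hc₂ δ hδ hδδ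
  have hev := H L T c₀ c₁ c₂ δ hT hc₁ hcc hc₀ hc₂ hδ hδδ
  have hlim := ENNReal.tendsto_ofReal
    (SmallN.tendsto_remainder hN htail hδ (C * T) (C * δ ^ e))
  have h0 : 0 ≤ C * T * δ ^ (2 * α) := by positivity
  have h1 : 0 ≤ C * δ ^ e * δ ^ α := by positivity
  refine (limsup_le_limsup hev).trans ((SmallN.limsup_add_le_of_tendsto hlim ENNReal.ofReal_ne_top).trans ?_)
  rw [ENNReal.limsup_const_mul_of_ne_top ENNReal.ofReal_ne_top,
    ENNReal.ofReal_add h0 h1, add_assoc, mul_right_comm C T]
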